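/- **Setting.** Let $d\ge 3$, let $k\ge 3$ be odd, and let $\Omega\subset\mathbb{R}^d$ be a bounded Lipschitz polytope (more generally, a nonempty bounded open set with $\Omega=\operatorname{int}\overline{\Omega}$). Let $\mathcal{T}$ be a finite conforming simplicial mesh covering $\overline\Omega$, consisting of closed $d$-simplices. Let $\mathcal{S}$ be the set of all faces (of dimensions $0,\dots,d$) of simplices in $\mathcal{T}$, let $\mathcal{F}$ be the set of $(d-1)$-dimensional faces (facets), and $\mathcal{F}_\Omega=\{F\in\mathcal{F}: F\not\subset\partial\Omega\}$. For a vertex $\mathbf z$, let $\varphi_{\mathbf z}$ be the continuous piecewise affine hat function of $\mathbf z$; its restriction to a simplex $K\ni\mathbf z$ is the barycentric coordinate $\lambda_{K,\mathbf z}$. For $F\subset K$, $\lambda_{K,F}$ is the barycentric coordinate of the vertex of $K$ opposite to $F$. $P_n^{(a,b)}$ denotes the Jacobi polynomial with $P_n^{(a,b)}(1)=\binom{n+a}{n}$, and $\mathbb{P}_m(D)$ the polynomials of total degree at most $m$ on $D$ (in local variables if $D$ is a facet). Functions may jump across facets; $u|_K$ includes the trace on $\partial K$. *Non-conforming functions.*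 For $K\in\mathcal{T}$, $F\in\mathcal{F}$ set $$B_k^{\mathrm{CR},K}:=\frac1d\Bigl(-1+\sum_{\mathbf z\text{ vertex of }K}P_k^{(0,d-2)}(1-2\lambda_{K,\mathbf z})\Bigr)\ \text{on }K,$$ $$B_k^{\mathrm{CR},F}:=\begin{cases}P_k^{(0,d-2)}(1-2\lambda_{K,F})-B_k^{\mathrm{CR},K}&\text{on each }K\in\mathcal{T}\text{ with }F\subset K,\\0&\text{on all other simplices.}\end{cases}$$ *Spaces.* Let $S_k(\mathcal{T})$ be the space of functions in $C^0(\overline\Omega)$ that are polynomials of degree at most $k$ on each $K\in\mathcal{T}$, let $S_{k,0}(\mathcal{T})$ be its subspace of functions vanishing on $\partial\Omega$, and $$\mathrm{CR}_k(\mathcal{T}):=S_k(\mathcal{T})+\operatorname{span}\{B_k^{\mathrm{CR},F}:F\in\mathcal{F}\},\qquad \mathrm{CR}_{k,0}(\mathcal{T}):=S_{k,0}(\mathcal{T})+\operatorname{span}\{B_k^{\mathrm{CR},F}:F\in\mathcal{F}_\Omega\}.$$ *Bases.* Let $\mathcal{I}_k$ be the set of pairs $(\tau,\boldsymbol\alpha)$,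 where $\tau\in\mathcal{S}$ has dimension $\ell$ with $1\le\ell\le\min\{k-1,d\}$ and $\boldsymbol\alpha\in\mathbb{N}_0^\ell$ satisfies $|\boldsymbol\alpha|\le k-(\ell+1)$, and let $\mathcal{I}_{k,\Omega}$ be the set of those with $\tau\not\subset\partial\Omega$. With a fixed numbering $\mathbf A_0(\tau),\dots,\mathbf A_\ell(\tau)$ of the vertices of each $\tau$, put $$B_{\tau,\boldsymbol\alpha}:=\Bigl(\prod_{j=0}^{\ell}\varphi_{\mathbf A_j(\tau)}\Bigr)\,P^{\mathrm{bary}}_{\boldsymbol\alpha}\bigl(\varphi_{\mathbf A_0(\tau)},\dots,\varphi_{\mathbf A_\ell(\tau)}\bigr),$$ $$P^{\mathrm{bary}}_{\boldsymbol\alpha}(y_0,\dots,y_\ell):=\prod_{j=1}^{\ell}\sigma_j^{\alpha_j}P_{\alpha_j}^{(s_j,1)}\Bigl(\frac{2y_j}{\sigma_j}-1\Bigr),\quad \sigma_j:=y_0+\sum_{m=j}^{\ell}y_m,\quad s_j:=2\sum_{m=j+1}^{\ell}\alpha_m+2(\ell-j)+1$$ (a polynomial in $y_0,\dots,y_\ell$).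 The basis of $\mathrm{CR}_k(\mathcal{T})$ under consideration is $\{B_{\tau,\boldsymbol\alpha}:(\tau,\boldsymbol\alpha)\in\mathcal{I}_k\}\cup\{B_k^{\mathrm{CR},F}:F\in\mathcal{F}\}$, and that of $\mathrm{CR}_{k,0}(\mathcal{T})$ is $\{B_{\tau,\boldsymbol\alpha}:(\tau,\boldsymbol\alpha)\in\mathcal{I}_{k,\Omega}\}\cup\{B_k^{\mathrm{CR},F}:F\in\mathcal{F}_\Omega\}$. Functionals $J_i$ are a *bidual basis* for a basis $(b_i)$ if $J_i(b_j)=\delta_{i,j}$ for all $i,j$. *Functionals.* Let $\operatorname{mark}:\mathcal{S}\to\mathcal{T}\cup\mathcal{F}$ satisfy $\operatorname{mark}(K)=K$ for all $K\in\mathcal{T}$, and $\operatorname{mark}(\tau)\in\mathcal{F}$, $\tau\subseteq\operatorname{mark}(\tau)$ for all $\tau\in\mathcal{S}\setminus\mathcal{T}$. Consider functionals of the form $$J_{\tau,\boldsymbol\alpha}u=(g_{\tau,\boldsymbol\alpha},u)_{L^2(\operatorname{mark}(\tau))},\qquad J_F^{\mathrm{CR}}u=(g_F,u)_{L^2(F)},$$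 where $g_{\tau,\boldsymbol\alpha}\in L^2(\operatorname{mark}(\tau))$ if $\operatorname{mark}(\tau)\in\mathcal{T}$, $g_{\tau,\boldsymbol\alpha}\in\mathbb{P}_{k-1}(\operatorname{mark}(\tau))$ if $\operatorname{mark}(\tau)\in\mathcal{F}$, and $g_F\in\mathbb{P}_{k-1}(F)$. (In the integrals over a facet, the trace of $u$ is taken from one of the adjacent simplices; on the Crouzeix–Raviart spaces the value does not depend on which one.) **Theorem.** For every such $\mathcal{T}$, numbering and $\operatorname{mark}$: 1. There are no functionals of this form such that the family $J_{\tau,\boldsymbol\alpha}$, $(\tau,\boldsymbol\alpha)\in\mathcal{I}_k$, together with $J_F^{\mathrm{CR}}$, $F\in\mathcal{F}$, is a bidual basis for $\mathrm{CR}_k(\mathcal{T})$ (with respect to the basis above). 2. If there is $K\in\mathcal{T}$ with $K\cap\partial\Omega=\emptyset$, then there are no functionals of this form such that the family $J_{\tau,\boldsymbol\alpha}$, $(\tau,\boldsymbol\alpha)\in\mathcal{I}_{k,\Omega}$, together with $J_F^{\mathrm{CR}}$, $F\in\mathcal{F}_\Omega$, is a bidual basis for $\mathrm{CR}_{k,0}(\mathcal{T})$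 (with respect to the basis above). -/

import Mathlib

open MeasureTheory
open scoped MeasureTheory Topology

namespace CrouzeixRaviart

noncomputable section

/-- Euclidean space `ℝ^d`. -/
abbrev Pt (d : ℕ) : Type := EuclideanSpace ℝ (Fin d)

/-- The closed simplex with vertex set `τ`. -/
def simplex {d : ℕ} (τ : Finset (Pt d)) : Set (Pt d) := convexHull ℝ (τ : Set (Pt d))

/-! ### Jacobi polynomials -/

/-- The Jacobi polynomial `P_n^{(a,b)}` with its usual normalization
`P_n^{(a,b)}(1) = (a+1)_n / n!`, for integer parameters `a, b ≥ 0`. -/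
def jacobi (a b n : ℕ) (x : ℝ) : ℝ :=
  ∑ m ∈ Finset.range (n + 1), ((n + a).choose m : ℝ) * ((n + b).choose (n - m) : ℝ) *
    ((x - 1) / 2) ^ (n - m) * ((x + 1) / 2) ^ m

/-- The homogenized Jacobi polynomial: the polynomial in `(y, s)` that is formally
`s ^ n * P_n^{(a,b)} (2 y / s - 1)`; see `jacobiHom_eq`. -/
def jacobiHom (a b n : ℕ) (y s : ℝ) : ℝ :=
  ∑ m ∈ Finset.range (n + 1), ((n + a).choose m : ℝ) * ((n + b).choose (n - m) : ℝ) *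
    (y - s) ^ (n - m) * y ^ m

theorem jacobiHom_eq (a b n : ℕ) (y s : ℝ) (hs : s ≠ 0) :
    jacobiHom a b n y s = s ^ n * jacobi a b n (2 * y / s - 1) := by
  unfold jacobiHom jacobi
  rw [Finset.mul_sum]
  refine Finset.sum_congr rfl fun m hm => ?_
  have hm' : m ≤ n := Nat.lt_succ_iff.mp (Finset.mem_range.mp hm)
  have h1 : (2 * y / s - 1 - 1) / 2 = (y - s) / s := by field_simp; ring
  have h2 : (2 * y / s - 1 + 1) / 2 = y / s := by field_simp; ring
  have h3 : s ^ n = s ^ (n - m) * s ^ m := by rw [← pow_add, Nat.sub_add_cancel hm']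
  rw [h1, h2, h3, div_pow, div_pow]
  field_simp

/-- The polynomial `P_α^bary (y_0, ..., y_ℓ)`, i.e. formally
`∏_{j=1}^ℓ (y_0 + ∑_{m=j}^ℓ y_m)^{α_j} P_{α_j}^{(s_j,1)} (2 y_j / (y_0 + ∑_{m=j}^ℓ y_m) - 1)` with
`s_j = 2 ∑_{m=j+1}^ℓ α_m + 2 (ℓ - j) + 1`. The entry `α_j`, `1 ≤ j ≤ ℓ`, is `α (j - 1)`. -/
def baryPoly (ℓ : ℕ) (α : Fin ℓ → ℕ) (y : ℕ → ℝ) : ℝ :=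
  ∏ j : Fin ℓ,
    jacobiHom (2 * (∑ m ∈ Finset.Ioi j, α m) + 2 * (ℓ - (j.val + 1)) + 1) 1 (α j)
      (y (j.val + 1)) (y 0 + ∑ m ∈ Finset.Icc (j.val + 1) ℓ, y m)

/-! ### Polynomials of degree at most `m` -/

/-- `ℙ_m`: polynomial functions on `ℝ^d` of total degree at most `m`. A polynomial on a
`d`-dimensional simplex `K` is identified with its unique polynomial extension to `ℝ^d`; the
polynomials in local variables on a facet `F` are the restrictions of the elements of `ℙ_m`. -/
def polyLE (d m : ℕ) : Submodule ℝ (Pt d → ℝ) where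
  carrier := {f | ∃ p : MvPolynomial (Fin d) ℝ, p.totalDegree ≤ m ∧
    ∀ x : Pt d, f x = MvPolynomial.eval (fun i => x i) p}
  zero_mem' := ⟨0, by simp, by simp⟩
  add_mem' := by
    rintro f g ⟨p, hp, hf⟩ ⟨q, hq, hg⟩
    exact ⟨p + q, (MvPolynomial.totalDegree_add p q).trans (max_le hp hq), fun x => by
      simp [hf, hg]⟩
  smul_mem' := by
    rintro c f ⟨p, hp, hf⟩
    exact ⟨c • p, (MvPolynomial.totalDegree_smul_le c p).trans hp, fun x => by
      simp [hf, MvPolynomial.smul_eval]⟩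

theorem polyLE_mono {d m n : ℕ} (h : m ≤ n) : polyLE d m ≤ polyLE d n := by
  rintro f ⟨p, hp, hf⟩
  exact ⟨p, hp.trans h, hf⟩

theorem polyLE_one (d m : ℕ) : (fun _ => 1 : Pt d → ℝ) ∈ polyLE d m :=
  ⟨1, by simp, by simp⟩

theorem polyLE_mul {d m n : ℕ} {f g : Pt d → ℝ} (hf : f ∈ polyLE d m) (hg : g ∈ polyLE d n) :
    (fun x => f x * g x) ∈ polyLE d (m + n) := by
  obtain ⟨p, hp, hf⟩ := hf
  obtain ⟨q, hq, hg⟩ := hg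
  exact ⟨p * q, (MvPolynomial.totalDegree_mul p q).trans (add_le_add hp hq), fun x => by
    simp [hf, hg]⟩

theorem polyLE_pow {d m : ℕ} {f : Pt d → ℝ} (hf : f ∈ polyLE d m) (n : ℕ) :
    (fun x => f x ^ n) ∈ polyLE d (n * m) := by
  induction n with
  | zero => simpa using polyLE_one d 0
  | succ n ih =>
    have := polyLE_mul ih hf
    simpa [pow_succ, Nat.succ_mul] using this

theorem polyLE_prod {d : ℕ} {ι : Type*} (s : Finset ι) (n : ι → ℕ) (f : ι → Pt d → ℝ)
    (h : ∀ i ∈ s, f i ∈ polyLE d (n i)) :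
    (fun x => ∏ i ∈ s, f i x) ∈ polyLE d (∑ i ∈ s, n i) := by
  classical
  induction s using Finset.induction_on with
  | empty => simpa using polyLE_one d 0
  | insert a s ha ih =>
    have := polyLE_mul (h a (Finset.mem_insert_self a s))
      (ih fun i hi => h i (Finset.mem_insert_of_mem hi))
    simpa [Finset.prod_insert ha, Finset.sum_insert ha] using this

theorem polyLE_sum {d m : ℕ} {ι : Type*} (s : Finset ι) (f : ι → Pt d → ℝ)
    (h : ∀ i ∈ s, f i ∈ polyLE d m) : (fun x => ∑ i ∈ s, f i x) ∈ polyLE d m := by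
  have := (polyLE d m).sum_mem h
  convert this using 1
  ext x
  simp

theorem polyLE_affine {d : ℕ} (f : Pt d →ᵃ[ℝ] ℝ) : (fun x => f x) ∈ polyLE d 1 := by
  refine ⟨MvPolynomial.C (f 0) + ∑ i, MvPolynomial.C (f.linear (EuclideanSpace.single i 1)) *
    MvPolynomial.X i, ?_, fun x => ?_⟩
  · refine (MvPolynomial.totalDegree_add _ _).trans (max_le (by simp) ?_)
    refine MvPolynomial.totalDegree_finsetSum_le fun i _ => ?_
    refine (MvPolynomial.totalDegree_mul _ _).trans ?_
    simp
  · have h1 : f x = f.linear x + f 0 := by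
      have := f.map_vadd 0 x
      simpa using this
    have h2 : x = ∑ i, x i • EuclideanSpace.single i (1 : ℝ) := by
      ext j
      simp [Finset.sum_apply, Pi.single_apply]
    change f x = _
    rw [h1]
    conv_lhs => rw [h2]
    simp only [map_sum, map_smul, smul_eq_mul, map_add, map_mul, MvPolynomial.eval_C,
      MvPolynomial.eval_X]
    rw [add_comm]
    congr 1
    exact Finset.sum_congr rfl fun i _ => mul_comm _ _

theorem polyLE_jacobiHom {d : ℕ} (a b n : ℕ) {y s : Pt d → ℝ} (hy : y ∈ polyLE d 1)
    (hs : s ∈ polyLE d 1) : (fun x => jacobiHom a b n (y x) (s x)) ∈ polyLE d n := by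
  unfold jacobiHom
  refine polyLE_sum _ _ fun m hm => ?_
  have hm' : m ≤ n := Nat.lt_succ_iff.mp (Finset.mem_range.mp hm)
  have h := polyLE_mul (polyLE_pow ((polyLE d 1).sub_mem hy hs) (n - m)) (polyLE_pow hy m)
  have h' := (polyLE d _).smul_mem
    (((n + a).choose m : ℝ) * ((n + b).choose (n - m) : ℝ)) h
  have e : (n - m) * 1 + m * 1 = n := by omega
  rw [e] at h'
  convert h' using 1
  ext x
  simp [mul_assoc]

theorem polyLE_baryPoly {d ℓ : ℕ} (α : Fin ℓ → ℕ) {y : ℕ → Pt d → ℝ}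
    (hy : ∀ j, y j ∈ polyLE d 1) :
    (fun x => baryPoly ℓ α (fun j => y j x)) ∈ polyLE d (∑ j, α j) := by
  unfold baryPoly
  refine polyLE_prod _ _ _ fun j _ => ?_
  refine polyLE_jacobiHom _ _ _ (hy _) ?_
  exact (polyLE d 1).add_mem (hy 0) (polyLE_sum _ _ fun m _ => hy m)

/-! ### Conforming simplicial meshes -/

/-- A conforming simplicial finite element mesh of a nonempty bounded open set `Ω ⊆ ℝ^d` that
is the interior of its closure (as every Lipschitz domain is). The mesh is given by its simplicial
complex of faces (of all dimensions); it is finite, every face is a face of a `d`-dimensional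
simplex, and the simplices cover the closure of `Ω`. Faces are given by their vertex sets. -/
structure SimplicialMesh {d : ℕ} (Ω : Set (Pt d)) where
  complex : Geometry.SimplicialComplex ℝ (Pt d)
  finite : complex.faces.Finite
  pure : ∀ τ ∈ complex.faces, ∃ K ∈ complex.faces, K.card = d + 1 ∧ τ ⊆ K
  cover : complex.space = closure Ω
  regular : interior (closure Ω) = Ω
  nonempty : Ω.Nonempty

namespace SimplicialMesh

variable {d : ℕ} {Ω : Set (Pt d)} (T : SimplicialMesh Ω)

/-- All faces, of dimensions `0, ..., d`. -/
abbrev Face : Type := {τ : Finset (Pt d) // τ ∈ T.complex.faces}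

/-- The elements of the mesh, i.e. the `d`-dimensional simplices. -/
abbrev Cell : Type := {K : Finset (Pt d) // K ∈ T.complex.faces ∧ K.card = d + 1}

/-- The facets, i.e. the `(d-1)`-dimensional faces. -/
abbrev Facet : Type := {F : Finset (Pt d) // F ∈ T.complex.faces ∧ F.card = d}

/-- The vertices of a cell form an affine basis of `ℝ^d`. -/
def cellBasis (K : T.Cell) : AffineBasis K.1 ℝ (Pt d) where
  toFun := (↑)
  ind' := T.complex.indep K.2.1
  tot' := by
    rw [(T.complex.indep K.2.1).affineSpan_eq_top_iff_card_eq_finrank_add_one]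
    simp [K.2.2]

open Classical in
/-- The restriction to the cell `K` of the hat function of the vertex `z`: the barycentric
coordinate `λ_{K,z}` if `z` is a vertex of `K`, and `0` otherwise. -/
def bary (K : T.Cell) (z : Pt d) : Pt d →ᵃ[ℝ] ℝ :=
  if h : z ∈ K.1 then (T.cellBasis K).coord ⟨z, h⟩ else 0

/-- Functions on the mesh that may jump across facets: `u K` is the function `u` on the cell `K`,
including its trace on the boundary of `K`. -/
abbrev Broken : Type := T.Cell → Pt d → ℝ

/-- `S_k(T)`: continuous functions on the closure of `Ω` that are polynomials of degree at most
`k` on each cell. -/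
def conf (k : ℕ) : Submodule ℝ T.Broken where
  carrier := {v | (∀ K, v K ∈ polyLE d k) ∧
    ∃ f : Pt d → ℝ, ContinuousOn f (closure Ω) ∧ ∀ K : T.Cell, ∀ x ∈ simplex K.1, v K x = f x}
  zero_mem' := ⟨fun K => (polyLE d k).zero_mem, 0, continuousOn_const, fun K x _ => rfl⟩
  add_mem' := by
    rintro u v ⟨hu, f, hf, huf⟩ ⟨hv, g, hg, hvg⟩
    exact ⟨fun K => (polyLE d k).add_mem (hu K) (hv K), f + g, hf.add hg, fun K x hx => by
      simp [huf K x hx, hvg K x hx]⟩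
  smul_mem' := by
    rintro c u ⟨hu, f, hf, huf⟩
    exact ⟨fun K => (polyLE d k).smul_mem c (hu K), c • f, hf.const_smul c, fun K x hx => by
      simp [huf K x hx]⟩

/-- `S_{k,0}(T)`: the functions in `S_k(T)` that vanish on the boundary of `Ω`. -/
def conf₀ (k : ℕ) : Submodule ℝ T.Broken where
  carrier := {v | v ∈ T.conf k ∧
    ∀ K : T.Cell, ∀ x ∈ simplex K.1, x ∈ frontier Ω → v K x = 0}
  zero_mem' := ⟨(T.conf k).zero_mem, fun K x _ _ => rfl⟩
  add_mem' := by
    rintro u v ⟨hu, hu0⟩ ⟨hv, hv0⟩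
    exact ⟨(T.conf k).add_mem hu hv, fun K x hx hb => by simp [hu0 K x hx hb, hv0 K x hx hb]⟩
  smul_mem' := by
    rintro c u ⟨hu, hu0⟩
    exact ⟨(T.conf k).smul_mem c hu, fun K x hx hb => by simp [hu0 K x hx hb]⟩

/-- The non-conforming simplex function `B_k^{CR,K}` on `K`. -/
def simplexFun (k : ℕ) (K : T.Cell) (x : Pt d) : ℝ :=
  (1 / (d : ℝ)) * (-1 + ∑ z ∈ K.1, jacobi 0 (d - 2) k (1 - 2 * T.bary K z x))

open Classical in
/-- The non-conforming facet function `B_k^{CR,F}`: on the cells `K` that contain `F` it is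
`P_k^{(0,d-2)} (1 - 2 λ_{K,F}) - B_k^{CR,K}`, and it is zero on all others. Here `λ_{K,F}` is the
barycentric coordinate of the vertex of `K` opposite to `F`, the only element of `K \ F`. -/
def facetFun (k : ℕ) (F : T.Facet) : T.Broken := fun K x =>
  if F.1 ⊆ K.1 then
    jacobi 0 (d - 2) k (1 - 2 * ∑ z ∈ K.1 \ F.1, T.bary K z x) - T.simplexFun k K x
  else 0

/-- A facet that is not contained in the boundary of `Ω`. -/
abbrev InnerFacet : Type := {F : T.Facet // ¬ simplex F.1 ⊆ frontier Ω}

/-- The canonical Crouzeix-Raviart space `CR_k(T)` for odd `k`. -/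
def CR (k : ℕ) : Submodule ℝ T.Broken :=
  T.conf k ⊔ Submodule.span ℝ (Set.range (T.facetFun k))

/-- The canonical Crouzeix-Raviart space `CR_{k,0}(T)` for odd `k`. -/
def CR₀ (k : ℕ) : Submodule ℝ T.Broken :=
  T.conf₀ k ⊔ Submodule.span ℝ (Set.range fun F : T.InnerFacet => T.facetFun k F.1)

/-! ### The basis functions of the conforming part -/

/-- A fixed numbering `A_0(τ), ..., A_ℓ(τ)` of the vertices of every face `τ`. -/
structure Numbering where
  vertex : T.Face → ℕ → Pt d
  bijOn : ∀ τ : T.Face, Set.BijOn (vertex τ) {j | j < τ.1.card} (τ.1 : Set (Pt d))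

/-- For odd `k`, the set `𝓘_k` of all pairs `(τ, α)` of an `ℓ`-dimensional face `τ` with
`1 ≤ ℓ ≤ min (k - 1) d` and a multi-index `α ∈ ℕ₀^ℓ` with `|α| ≤ k - (ℓ + 1)`. -/
structure FaceIndex (k : ℕ) where
  dim : ℕ
  face : T.Face
  multi : Fin dim → ℕ
  card_face : face.1.card = dim + 1
  one_le_dim : 1 ≤ dim
  dim_le : dim ≤ min (k - 1) d
  sum_multi_le : ∑ j, multi j ≤ k - (dim + 1)

/-- The set `𝓘_{k,Ω}` of the pairs `(τ, α)` in `𝓘_k` with `τ` not contained in `∂Ω`. -/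
abbrev InnerFaceIndex (k : ℕ) : Type :=
  {i : T.FaceIndex k // ¬ simplex i.face.1 ⊆ frontier Ω}

variable {T}

/-- The basis function `B_{τ,α} = W_τ P_α^bary (φ_{A_0(τ)}, ..., φ_{A_ℓ(τ)})` in terms of the hat
functions `φ_z`, where `W_τ = ∏_{z ∈ τ} φ_z` is the face bubble. -/
def faceFun {k : ℕ} (A : T.Numbering) (i : T.FaceIndex k) : T.Broken := fun K x =>
  (∏ z ∈ i.face.1, T.bary K z x) *
    baryPoly i.dim i.multi (fun j => T.bary K (A.vertex i.face j) x)

/-! ### The basis functions belong to the Crouzeix-Raviart spaces -/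

theorem bary_vertex (K : T.Cell) (z y : Pt d) (hy : y ∈ K.1) [Decidable (z = y)] :
    T.bary K z y = if z = y then 1 else 0 := by
  classical
  unfold bary
  split_ifs with h h' h'
  · subst h'
    exact (T.cellBasis K).coord_apply_eq ⟨z, h⟩
  · exact (T.cellBasis K).coord_apply_ne (i := ⟨z, h⟩) (j := ⟨y, hy⟩)
      fun e => h' (congrArg Subtype.val e)
  · subst h'
    exact absurd hy h
  · rfl

theorem bary_of_notMem {K : T.Cell} {z : Pt d} (hz : z ∉ K.1) (x : Pt d) : T.bary K z x = 0 := by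
  simp [bary, hz]

theorem bary_nonneg (K : T.Cell) (z : Pt d) {x : Pt d} (hx : x ∈ simplex K.1) :
    0 ≤ T.bary K z x := by
  classical
  have hc : Convex ℝ {x : Pt d | 0 ≤ T.bary K z x} :=
    (convex_Ici (0 : ℝ)).affine_preimage (T.bary K z)
  refine convexHull_min (fun y hy => ?_) hc hx
  simp only [Set.mem_ofPred_eq, bary_vertex K z y hy]
  split_ifs <;> norm_num

/-- On the convex hull of vertices of `K` other than `z` the coordinate of `z` vanishes. -/
theorem bary_eq_zero (K : T.Cell) (z : Pt d) {s : Set (Pt d)} (hs : s ⊆ K.1) (hz : z ∉ s)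
    {x : Pt d} (hx : x ∈ convexHull ℝ s) : T.bary K z x = 0 := by
  classical
  have hc : Convex ℝ {x : Pt d | T.bary K z x = 0} :=
    (convex_singleton (0 : ℝ)).affine_preimage (T.bary K z)
  refine convexHull_min (fun y hy => ?_) hc hx
  have hne : z ≠ y := fun e => hz (e ▸ hy)
  simp [bary_vertex K z y (hs hy), hne]

theorem bary_agree (K K' : T.Cell) (z : Pt d) {x : Pt d} (hx : x ∈ simplex K.1)
    (hx' : x ∈ simplex K'.1) : T.bary K z x = T.bary K' z x := by
  classical
  have hc : Convex ℝ {x : Pt d | (T.bary K z - T.bary K' z) x = 0} :=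
    (convex_singleton (0 : ℝ)).affine_preimage (T.bary K z - T.bary K' z)
  have := convexHull_min (t := {x : Pt d | (T.bary K z - T.bary K' z) x = 0}) (fun y hy => ?_) hc
    (T.complex.inter_subset_convexHull K.2.1 K'.2.1 ⟨hx, hx'⟩)
  · simpa [sub_eq_zero] using this
  · simp [bary_vertex K z y hy.1, bary_vertex K' z y hy.2]

theorem sum_bary_smul (K : T.Cell) (x : Pt d) : ∑ z ∈ K.1, T.bary K z x • z = x := by
  rw [← Finset.sum_coe_sort]
  conv_rhs => rw [← (T.cellBasis K).linear_combination_coord_eq_self x]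
  refine Finset.sum_congr rfl fun z _ => ?_
  simp only [bary, z.2, dite_true]
  rfl

theorem sum_bary (K : T.Cell) (x : Pt d) : ∑ z ∈ K.1, T.bary K z x = 1 := by
  rw [← Finset.sum_coe_sort]
  conv_rhs => rw [← (T.cellBasis K).sum_coord_apply_eq_one x]
  refine Finset.sum_congr rfl fun z _ => ?_
  simp [bary]

theorem mem_simplex_of_bary (K : T.Cell) (s : Finset (Pt d)) (hs : s ⊆ K.1) (x : Pt d)
    (h0 : ∀ z ∈ K.1, 0 ≤ T.bary K z x) (h1 : ∀ z ∈ K.1, z ∉ s → T.bary K z x = 0) :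
    x ∈ simplex s := by
  refine Finset.mem_convexHull'.2 ⟨fun z => T.bary K z x, fun z hz => h0 z (hs hz), ?_, ?_⟩
  · rw [Finset.sum_subset hs h1, sum_bary]
  · rw [Finset.sum_subset hs (fun z hz hzs => by simp [h1 z hz hzs]), sum_bary_smul]

theorem exists_cell {x : Pt d} (hx : x ∈ closure Ω) : ∃ K : T.Cell, x ∈ simplex K.1 := by
  rw [← T.cover, Geometry.SimplicialComplex.mem_space_iff] at hx
  obtain ⟨τ, hτ, hx⟩ := hx
  obtain ⟨K, hK, hc, hτK⟩ := T.pure τ hτ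
  exact ⟨⟨K, hK, hc⟩, convexHull_mono (Finset.coe_subset.2 hτK) hx⟩

theorem simplex_subset (K : T.Cell) : simplex K.1 ⊆ closure Ω := by
  rw [← T.cover]
  exact Geometry.SimplicialComplex.convexHull_subset_space K.2.1

theorem isClosed_simplex (τ : Finset (Pt d)) : IsClosed (simplex τ) :=
  (τ.finite_toSet.isCompact_convexHull ℝ).isClosed

theorem finite_cell : Finite T.Cell :=
  (T.finite.subset fun _ h => h.1 : {K | K ∈ T.complex.faces ∧ K.card = d + 1}.Finite).to_subtype

theorem faceFun_mem_conf {k : ℕ} (A : T.Numbering) (i : T.FaceIndex k) :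
    faceFun A i ∈ T.conf k := by
  classical
  have hpoly : ∀ K, faceFun A i K ∈ polyLE d k := fun K => by
    have h := polyLE_mul
      (polyLE_prod i.face.1 (fun _ => 1) (fun z x => T.bary K z x)
        fun z _ => polyLE_affine (T.bary K z))
      (polyLE_baryPoly i.multi (y := fun j x => T.bary K (A.vertex i.face j) x)
        fun j => polyLE_affine _)
    refine polyLE_mono ?_ h
    have h1 := i.sum_multi_le
    have h2 := i.dim_le
    have h3 := i.one_le_dim
    have h4 := i.card_face
    simp only [Finset.sum_const, smul_eq_mul, mul_one]
    omega
  have hagree : ∀ K K' : T.Cell, ∀ x ∈ simplex K.1, x ∈ simplex K'.1 →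
      faceFun A i K x = faceFun A i K' x := fun K K' x hx hx' => by
    unfold faceFun
    simp only [fun z => bary_agree K K' z hx hx']
  refine ⟨hpoly, fun x => if h : ∃ K : T.Cell, x ∈ simplex K.1 then faceFun A i h.choose x else 0,
    ?_, fun K x hx => ?_⟩
  · have : Finite T.Cell := finite_cell
    have hcov : closure Ω = ⋃ K : T.Cell, simplex K.1 := by
      refine Set.Subset.antisymm (fun x hx => Set.mem_iUnion.2 (exists_cell hx)) ?_
      exact Set.iUnion_subset simplex_subset
    rw [hcov]
    refine (locallyFinite_of_finite _).continuousOn_iUnion (fun K => isClosed_simplex K.1)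
      fun K => ?_
    have hcont : Continuous (faceFun A i K) := by
      obtain ⟨p, -, hp⟩ := hpoly K
      rw [funext hp]
      exact (MvPolynomial.continuous_eval p).comp (by fun_prop)
    refine hcont.continuousOn.congr fun x hx => ?_
    have h : ∃ K : T.Cell, x ∈ simplex K.1 := ⟨K, hx⟩
    simp only [dif_pos h]
    exact hagree _ _ x h.choose_spec hx
  · have h : ∃ K : T.Cell, x ∈ simplex K.1 := ⟨K, hx⟩
    simp only [dif_pos h]
    exact hagree _ _ x hx h.choose_spec

/-- If `x ∈ ∂Ω` has positive coordinates for all vertices of the face `τ` of `K`, then `τ` is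
contained in `∂Ω`. -/
theorem simplex_subset_frontier (K : T.Cell) {τ : Finset (Pt d)} {x : Pt d}
    (hx : x ∈ simplex K.1) (hxb : x ∈ frontier Ω) (hτ : ∀ z ∈ τ, T.bary K z x ≠ 0) :
    simplex τ ⊆ frontier Ω := by
  classical
  have hopen : IsOpen Ω := T.regular ▸ isOpen_interior
  have hτK : τ ⊆ K.1 := fun z hz => by
    by_contra h
    exact hτ z hz (bary_of_notMem h x)
  intro y hy
  by_contra hyb
  have hyK : y ∈ simplex K.1 := convexHull_mono (Finset.coe_subset.2 hτK) hy
  have hyΩ : y ∈ Ω := by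
    by_contra h
    exact hyb (by rw [hopen.frontier_eq]; exact ⟨simplex_subset K hyK, h⟩)
  have hxΩ : x ∉ Ω := by
    rw [hopen.frontier_eq] at hxb
    exact hxb.2
  set σ := K.1.filter fun z => T.bary K z x ≠ 0 with hσ
  have hσK : σ ⊆ K.1 := Finset.filter_subset _ _
  -- a point of `Ω` in the relative interior of `σ`
  obtain ⟨δ, hδ0, hδ1, hδΩ⟩ : ∃ δ : ℝ, 0 < δ ∧ δ < 1 ∧ AffineMap.lineMap y x δ ∈ Ω := by
    have hc : ContinuousAt (fun δ : ℝ => (AffineMap.lineMap y x δ : Pt d)) 0 := by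
      simp only [AffineMap.lineMap_apply_module]
      fun_prop
    have h1 : ∀ᶠ δ : ℝ in 𝓝[>] 0, (AffineMap.lineMap y x δ : Pt d) ∈ Ω := by
      refine nhdsWithin_le_nhds (hc.eventually_mem ?_)
      simpa using hopen.mem_nhds hyΩ
    have h2 : ∀ᶠ δ : ℝ in 𝓝[>] 0, δ < 1 := nhdsWithin_le_nhds (gt_mem_nhds one_pos)
    obtain ⟨δ, ⟨a, b⟩, c⟩ := ((h1.and h2).and self_mem_nhdsWithin).exists
    exact ⟨δ, c, b, a⟩
  set y' : Pt d := AffineMap.lineMap y x δ with hy'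
  have hyb' : ∀ z, T.bary K z y' = (1 - δ) * T.bary K z y + δ * T.bary K z x := fun z => by
    rw [hy', AffineMap.apply_lineMap, AffineMap.lineMap_apply_module]
    simp
  have hpos : ∀ z ∈ σ, 0 < T.bary K z y' := fun z hz => by
    have hz' := (Finset.mem_filter.1 hz).2
    have hxp : 0 < T.bary K z x := lt_of_le_of_ne (bary_nonneg K z hx) (Ne.symm hz')
    rw [hyb']
    have := bary_nonneg K z hyK
    have h3 : 0 ≤ (1 - δ) * T.bary K z y := mul_nonneg (by linarith) this
    have h4 : 0 < δ * T.bary K z x := mul_pos hδ0 hxp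
    linarith
  have hzero : ∀ z ∈ K.1, z ∉ σ → T.bary K z x = 0 ∧ T.bary K z y' = 0 := fun z hzK hz => by
    have hx0 : T.bary K z x = 0 := by
      by_contra h
      exact hz (Finset.mem_filter.2 ⟨hzK, h⟩)
    refine ⟨hx0, ?_⟩
    have hzτ : z ∉ (τ : Set (Pt d)) := fun h => hτ z h hx0
    rw [hyb', hx0, bary_eq_zero K z (Finset.coe_subset.2 hτK) hzτ hy]
    simp
  -- a point of `σ` slightly beyond `x`
  obtain ⟨t, ht0, htn⟩ : ∃ t : ℝ, 0 < t ∧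
      ∀ z ∈ σ, 0 ≤ (1 + t) * T.bary K z x - t * T.bary K z y' := by
    have h1 : ∀ z ∈ σ, ∀ᶠ t : ℝ in 𝓝[>] 0,
        0 ≤ (1 + t) * T.bary K z x - t * T.bary K z y' := fun z hz => by
      have hz' := (Finset.mem_filter.1 hz).2
      have hxp : 0 < T.bary K z x := lt_of_le_of_ne (bary_nonneg K z hx) (Ne.symm hz')
      have hc : ContinuousAt
          (fun t : ℝ => (1 + t) * T.bary K z x - t * T.bary K z y') 0 := by fun_prop
      have : ∀ᶠ t : ℝ in 𝓝 0, (1 + t) * T.bary K z x - t * T.bary K z y' ∈ Set.Ioi (0 : ℝ) :=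
        hc.eventually_mem (by simpa using Ioi_mem_nhds hxp)
      exact nhdsWithin_le_nhds (this.mono fun t ht => le_of_lt ht)
    have h2 : ∀ᶠ t : ℝ in 𝓝[>] 0, ∀ z ∈ σ,
        0 ≤ (1 + t) * T.bary K z x - t * T.bary K z y' :=
      (Filter.eventually_all_finset σ).2 h1
    obtain ⟨t, a, b⟩ := (h2.and self_mem_nhdsWithin).exists
    exact ⟨t, b, a⟩
  set w : Pt d := AffineMap.lineMap y' x (1 + t) with hw
  have hwb : ∀ z, T.bary K z w = (1 + t) * T.bary K z x - t * T.bary K z y' := fun z => by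
    rw [hw, AffineMap.apply_lineMap, AffineMap.lineMap_apply_module]
    simp only [smul_eq_mul]
    ring
  have hwσ : w ∈ simplex σ := by
    refine mem_simplex_of_bary K σ hσK w (fun z hz => ?_) fun z hz hzσ => ?_
    · by_cases h : z ∈ σ
      · rw [hwb]
        exact htn z h
      · rw [hwb, (hzero z hz h).1, (hzero z hz h).2]
        simp
    · rw [hwb, (hzero z hz hzσ).1, (hzero z hz hzσ).2]
      simp
  -- the cells near `y'` contain `σ`
  have hnear : ∀ᶠ p in 𝓝 y', ∀ K' : T.Cell, p ∈ simplex K'.1 → y' ∈ simplex K'.1 := by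
    have : Finite T.Cell := finite_cell
    refine Filter.eventually_all.2 fun K' => ?_
    by_cases h : y' ∈ simplex K'.1
    · exact Filter.Eventually.of_forall fun _ _ => h
    · filter_upwards [(isClosed_simplex K'.1).isOpen_compl.mem_nhds h] with p hp hp'
      exact absurd hp' hp
  have hy'K : y' ∈ simplex K.1 := by
    refine mem_simplex_of_bary K K.1 (Finset.Subset.refl _) y' (fun z hz => ?_)
      fun z hz hz' => absurd hz hz'
    by_cases h : z ∈ σ
    · exact (hpos z h).le
    · exact (hzero z hz h).2.ge
  have hcell : ∀ᶠ p in 𝓝 y', ∃ K' : T.Cell, p ∈ simplex K'.1 ∧ w ∈ simplex K'.1 := by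
    filter_upwards [hnear, hopen.mem_nhds hδΩ] with p hp hpΩ
    obtain ⟨K', hK'⟩ := exists_cell (T := T) (subset_closure hpΩ)
    refine ⟨K', hK', ?_⟩
    have hmem := T.complex.inter_subset_convexHull K.2.1 K'.2.1 ⟨hy'K, hp K' hK'⟩
    have hσK' : σ ⊆ K'.1 := fun z hz => by
      by_contra h
      have := bary_eq_zero K z Set.inter_subset_left (fun h' => h h'.2) hmem
      exact (hpos z hz).ne' this
    exact convexHull_mono (Finset.coe_subset.2 hσK') hwσ
  -- hence a neighbourhood of `x` is covered by cells
  have ht1 : (0 : ℝ) < 1 + t := by linarith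
  have hwx : w = (1 + t) • x - t • y' := by
    rw [hw, AffineMap.lineMap_apply_module]
    module
  let φ : Pt d → Pt d := fun q => t⁻¹ • ((1 + t) • q - w)
  have hφx : φ x = y' := by
    simp only [φ, hwx, sub_sub_cancel, smul_smul, inv_mul_cancel₀ ht0.ne', one_smul]
  have hφc : Filter.Tendsto φ (𝓝 x) (𝓝 y') := by
    have : ContinuousAt φ x := by fun_prop
    rw [← hφx]
    exact this
  have hxint : x ∈ interior (closure Ω) := by
    rw [mem_interior_iff_mem_nhds]
    filter_upwards [hφc.eventually hcell] with q hq
    obtain ⟨K', h1, h2⟩ := hq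
    refine simplex_subset K' ?_
    have hq : q = (1 / (1 + t)) • w + (t / (1 + t)) • φ q := by
      simp only [φ, smul_smul, smul_sub]
      rw [show t / (1 + t) * (t⁻¹ * (1 + t)) = 1 by field_simp,
        show t / (1 + t) * t⁻¹ = 1 / (1 + t) by field_simp]
      module
    rw [hq]
    exact convex_convexHull ℝ _ h2 h1 (by positivity) (by positivity) (by field_simp)
  rw [T.regular] at hxint
  exact hxΩ hxint

theorem faceFun_mem_conf₀ {k : ℕ} (A : T.Numbering) (i : T.InnerFaceIndex k) :
    faceFun A i.1 ∈ T.conf₀ k := by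
  refine ⟨faceFun_mem_conf A i.1, fun K x hx hb => ?_⟩
  by_contra h
  refine i.2 (simplex_subset_frontier K hx hb fun z hz h0 => h ?_)
  unfold faceFun
  rw [Finset.prod_eq_zero hz h0, zero_mul]

/-! ### The bases of the Crouzeix-Raviart spaces and the functionals -/

/-- For odd `k`, the family `B_{τ,α}`, `(τ,α) ∈ 𝓘_k`, and `B_k^{CR,F}`, `F` any facet, in
`CR_k(T)`. -/
def basisCR {k : ℕ} (A : T.Numbering) : T.FaceIndex k ⊕ T.Facet → T.CR k
  | .inl i => ⟨faceFun A i, Submodule.mem_sup_left (faceFun_mem_conf A i)⟩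
  | .inr F => ⟨T.facetFun k F, Submodule.mem_sup_right (Submodule.subset_span ⟨F, rfl⟩)⟩

/-- For odd `k`, the family `B_{τ,α}`, `(τ,α) ∈ 𝓘_{k,Ω}`, and `B_k^{CR,F}`, `F` any facet not
contained in `∂Ω`, in `CR_{k,0}(T)`. -/
def basisCR₀ {k : ℕ} (A : T.Numbering) : T.InnerFaceIndex k ⊕ T.InnerFacet → T.CR₀ k
  | .inl i => ⟨faceFun A i.1, Submodule.mem_sup_left (faceFun_mem_conf₀ A i)⟩
  | .inr F => ⟨T.facetFun k F.1, Submodule.mem_sup_right (Submodule.subset_span ⟨F, rfl⟩)⟩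

variable (T) in
/-- The assignment function maps every cell to itself and every other face to a facet that
contains it. -/
def IsAssignment (mark : T.Face → T.Cell ⊕ T.Facet) : Prop :=
  (∀ K : T.Cell, mark ⟨K.1, K.2.1⟩ = Sum.inl K) ∧
  ∀ τ : T.Face, τ.1.card ≠ d + 1 → ∃ F : T.Facet, mark τ = Sum.inr F ∧ τ.1 ⊆ F.1

/-- `J = (g, ·)_{L²(K)}` for some `g ∈ L²(K)`. -/
def IsCellFunctional {V : Submodule ℝ T.Broken} (K : T.Cell) (J : Module.Dual ℝ V) : Prop :=
  ∃ g : Pt d → ℝ, MemLp g 2 (volume.restrict (simplex K.1)) ∧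
    ∀ u : V, J u = ∫ x in simplex K.1, g x * u.1 K x

/-- `J = (g, ·)_{L²(F)}` for some `g ∈ ℙ_{k-1}(F)`, with respect to the surface measure of `F`.
The trace on `F` is taken from one of the cells that contain `F`; for functions in the
Crouzeix-Raviart spaces the value does not depend on the choice of this cell, because the jumps
are orthogonal to `ℙ_{k-1}(F)`. -/
def IsFacetFunctional {V : Submodule ℝ T.Broken} (k : ℕ) (F : T.Facet) (J : Module.Dual ℝ V) :
    Prop :=
  ∃ g ∈ polyLE d (k - 1), ∃ K : T.Cell, F.1 ⊆ K.1 ∧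
    ∀ u : V, J u = ∫ x in simplex F.1, g x * u.1 K x ∂μHE[d - 1]

/-- `J` is a functional of the form required for the face `τ`. -/
def IsFaceFunctional {V : Submodule ℝ T.Broken} (k : ℕ) (mark : T.Face → T.Cell ⊕ T.Facet)
    (τ : T.Face) (J : Module.Dual ℝ V) : Prop :=
  (∀ K, mark τ = Sum.inl K → IsCellFunctional K J) ∧
  ∀ F, mark τ = Sum.inr F → IsFacetFunctional k F J

end SimplicialMesh

open Classical in
/-- The functionals `J i` are bidual to the family `b`, i.e. `J i (b j) = δ_{ij}`. -/
def IsBidual {ι V : Type*} [AddCommGroup V] [Module ℝ V] (b : ι → V) (J : ι → Module.Dual ℝ V) :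
    Prop :=
  ∀ i j, J i (b j) = if i = j then 1 else 0

end

end CrouzeixRaviart

namespace CrouzeixRaviart

noncomputable section

/-! ### Homogenized Jacobi polynomials as a spanning family -/

/-! Both claims fail at a single facet functional: if `g` has degree at most `k - 1` on a facet `F`
and is orthogonal on `F` to every `B_{τ,α}` with `τ ⊆ F`, then it is also orthogonal to the trace of
`B_k^{CR,F}`, so `J_F (B_k^{CR,F}) = 0` instead of `1`.

Work modulo the functions orthogonal to `g` on `F`. The `B_{τ,α}` with `τ ⊆ F` span all polynomials
of degree at most `k` on `F` that vanish at the vertices (`bubble_mul_mem_orthMod`,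
`monomial_cases`), so a polynomial of degree at most `k` is determined by its vertex values: `f ≡
∑_z f(z) λ_z^k` (`sub_vertex_values_mem_orthMod`). With `P = ∑_z λ_z^k` this gives `1 ≡ P`. The
function `q_w = P_k^{(0,d-2)}(1 - 2λ_w)` is `1` at the vertices other than `w` and `p =
P_k^{(0,d-2)}(-1)` at `w`, so `q_w ≡ P + (p - 1) λ_w^k`. On the other hand `q_w` is orthogonal on
`F` to all polynomials of degree below `k` (`jacobi_mem_orthMod`), hence `q_w ≡ 0`. Summing over the
`d` vertices, `(d + p - 1) P ≡ 0`. For odd `k`, `p = -binom(k+d-2, k) < -(d - 1)`, so the factor is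
nonzero and `1 ≡ P ≡ 0`. The trace of `B_k^{CR,F}` on `F` is `1 - (1/d) ∑_{w ∈ F} q_w ≡ 0`.

The analytic ingredient is the orthogonality of `q_w`: slices of `F` near the vertex `w` are
homothetic copies of `F`, which turns the integrals into Beta integrals. The algebraic ingredient is
that the polynomials `P_α^bary`, multiplied by powers of `∑ y_j`, span all homogeneous polynomials.
-/

theorem mul_sup_pow_le {R A : Type*} [CommSemiring R] [CommSemiring A] [Algebra R A]
    (a b S : Submodule R A) (n : ℕ) (c : Submodule R A)
    (h : ∀ e f, e + f = n → c * a ^ e * b ^ f ≤ S) : c * (a ⊔ b) ^ n ≤ S := by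
  -- The multiplier `c` absorbs the factor split off from the power, so the induction never has to
  -- reorder a binomial expansion.
  induction n generalizing c with
  | zero => simpa using h 0 0 rfl
  | succ n ih =>
    rw [pow_succ', ← mul_assoc, Submodule.mul_sup, Submodule.sup_mul]
    refine sup_le (ih _ fun e f hef => ?_) (ih _ fun e f hef => ?_)
    · refine le_trans (le_of_eq ?_) (h (e + 1) f (by omega))
      ring
    · refine le_trans (le_of_eq ?_) (h e (f + 1) (by omega))
      ring

theorem sup_pow_le {R A : Type*} [CommSemiring R] [CommSemiring A] [Algebra R A]
    (a b S : Submodule R A) (n : ℕ) (h : ∀ e f, e + f = n → a ^ e * b ^ f ≤ S) :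
    (a ⊔ b) ^ n ≤ S := by
  have := mul_sup_pow_le a b S n 1 (by simpa using h)
  simpa using this

theorem prod_mem_pow_card {R A ι : Type*} [CommSemiring R] [CommSemiring A] [Algebra R A]
    (V : Submodule R A) (s : Finset ι) (n : ι → ℕ) (f : ι → A) (h : ∀ i ∈ s, f i ∈ V ^ n i) :
    ∏ i ∈ s, f i ∈ V ^ ∑ i ∈ s, n i := by
  classical
  induction s using Finset.induction_on with
  | empty => simp [Submodule.one_le.1 le_rfl]
  | insert a s ha ih =>
    rw [Finset.prod_insert ha, Finset.sum_insert ha, pow_add]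
    exact Submodule.mul_mem_mul (h a (Finset.mem_insert_self a s))
      (ih fun i hi => h i (Finset.mem_insert_of_mem hi))

variable {X : Type*}

/-- The homogenized Jacobi polynomial of two functions. -/
def jacobiFun (a b n : ℕ) (y s : X → ℝ) : X → ℝ := fun x => jacobiHom a b n (y x) (s x)

theorem jacobiFun_eq (a b n : ℕ) (y s : X → ℝ) :
    jacobiFun a b n y s = ∑ m ∈ Finset.range (n + 1),
      (((n + a).choose m : ℝ) * ((n + b).choose (n - m) : ℝ)) • ((y - s) ^ (n - m) * y ^ m) := by
  ext x
  simp [jacobiFun, jacobiHom, mul_assoc]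

theorem jacobiFun_mem_pow (a b n : ℕ) {y s : X → ℝ} {V : Submodule ℝ (X → ℝ)} (hy : y ∈ V)
    (hs : s ∈ V) : jacobiFun a b n y s ∈ V ^ n := by
  rw [jacobiFun_eq]
  refine Submodule.sum_mem _ fun m hm => Submodule.smul_mem _ _ ?_
  have hm' : m ≤ n := Nat.lt_succ_iff.mp (Finset.mem_range.mp hm)
  have := Submodule.mul_mem_mul (Submodule.pow_mem_pow V (V.sub_mem hy hs) (n - m))
    (Submodule.pow_mem_pow V hy m)
  rwa [← pow_add, Nat.sub_add_cancel hm'] at this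

/-- Replacing one factor `y - s` by `y` changes the product by a multiple of `s`. -/
theorem sub_pow_mul_pow_mem (y s : X → ℝ) (p m n : ℕ) (h : p + m = n + 1) :
    (y - s) ^ p * y ^ m - y ^ (n + 1) ∈
      Submodule.span ℝ {s} * (Submodule.span ℝ {y, s}) ^ n := by
  have hy : y ∈ Submodule.span ℝ {y, s} := Submodule.subset_span (by simp)
  have hs : s ∈ Submodule.span ℝ {y, s} := Submodule.subset_span (by simp)
  induction p generalizing m with
  | zero => simp [← h]
  | succ p ih =>
    have h1 := ih (m + 1) (by omega)
    have h2 : s * ((y - s) ^ p * y ^ m) ∈ Submodule.span ℝ {s} * (Submodule.span ℝ {y, s}) ^ n := by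
      refine Submodule.mul_mem_mul (Submodule.mem_span_singleton_self s) ?_
      have := Submodule.mul_mem_mul (Submodule.pow_mem_pow _ (Submodule.sub_mem _ hy hs) p)
        (Submodule.pow_mem_pow _ hy m)
      rwa [← pow_add, show p + m = n by omega] at this
    have := Submodule.sub_mem _ h1 h2
    convert this using 1
    ring

/-- The span of the polynomials `s ^ e * P_m (y, s)`, `e + m = n`. -/
def jacobiSpan (a b n : ℕ) (y s : X → ℝ) : Submodule ℝ (X → ℝ) :=
  Submodule.span ℝ {f | ∃ e m, e + m = n ∧ f = s ^ e * jacobiFun a b m y s}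

/-- Triangularity: modulo multiples of `s`, the polynomial of degree `n` is a positive multiple of
`y ^ n`, and the multiples of `s` are covered by induction. The parameters `a`, `b` play no role, so
they may later depend on the other indices. -/
theorem span_pair_pow_le (a b n : ℕ) (y s : X → ℝ) :
    (Submodule.span ℝ {y, s}) ^ n ≤ jacobiSpan a b n y s := by
  induction n with
  | zero =>
    rw [pow_zero, Submodule.one_eq_span_one_set]
    refine Submodule.span_le.2 ?_
    rintro _ rfl
    refine Submodule.subset_span ⟨0, 0, rfl, ?_⟩
    simp [jacobiFun_eq]
  | succ n ih =>
    have hs : Submodule.span ℝ {s} * (Submodule.span ℝ {y, s}) ^ n ≤ jacobiSpan a b (n + 1) y s := by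
      refine (_root_.mul_le_mul' le_rfl ih).trans ?_
      rw [jacobiSpan, Submodule.span_mul_span, Submodule.span_le]
      rintro _ ⟨_, rfl, _, ⟨e, m, hem, rfl⟩, rfl⟩
      refine Submodule.subset_span ⟨e + 1, m, by omega, ?_⟩
      simp only [pow_succ', mul_assoc]
    -- The value of the homogenized Jacobi polynomial at `y = 1`, `s = 0`; all its terms are
    -- nonnegative.
    set c : ℝ := ∑ m ∈ Finset.range (n + 1 + 1),
      (((n + 1 + a).choose m : ℝ) * ((n + 1 + b).choose (n + 1 - m) : ℝ)) with hc
    have hcpos : 0 < c := by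
      refine Finset.sum_pos' (fun m _ => by positivity) ⟨n + 1, by simp, ?_⟩
      have : 0 < (n + 1 + a).choose (n + 1) := Nat.choose_pos (by omega)
      simpa using this
    have hy : y ^ (n + 1) ∈ jacobiSpan a b (n + 1) y s := by
      have h1 : jacobiFun a b (n + 1) y s - c • y ^ (n + 1) ∈ jacobiSpan a b (n + 1) y s := by
        rw [jacobiFun_eq, hc, Finset.sum_smul, ← Finset.sum_sub_distrib]
        refine Submodule.sum_mem _ fun m hm => ?_
        rw [← smul_sub]
        have hm' : m ≤ n + 1 := Nat.lt_succ_iff.mp (Finset.mem_range.mp hm)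
        exact Submodule.smul_mem _ _ (hs (sub_pow_mul_pow_mem y s _ _ n (by omega)))
      have h2 : jacobiFun a b (n + 1) y s ∈ jacobiSpan a b (n + 1) y s :=
        Submodule.subset_span ⟨0, n + 1, by omega, by simp⟩
      have h3 := Submodule.smul_mem _ c⁻¹ (Submodule.sub_mem _ h2 h1)
      rwa [sub_sub_cancel, smul_smul, inv_mul_cancel₀ hcpos.ne', one_smul] at h3
    have hpair : (Submodule.span ℝ {y, s} : Submodule ℝ (X → ℝ)) =
        Submodule.span ℝ {y} ⊔ Submodule.span ℝ {s} := Submodule.span_insert _ _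
    nth_rw 1 [hpair]
    refine sup_pow_le _ _ _ _ fun e f hef => ?_
    rcases f with _ | f
    · obtain rfl : e = n + 1 := by omega
      simpa [Submodule.span_pow] using hy
    · refine le_trans ?_ hs
      rw [pow_succ', mul_left_comm, show n = e + f by omega, pow_add]
      refine _root_.mul_le_mul' le_rfl (_root_.mul_le_mul' ?_ ?_)
      · exact pow_le_pow_left' (Submodule.span_mono (by simp)) _
      · exact pow_le_pow_left' (Submodule.span_mono (by simp)) _

/-! ### The polynomials `P_α^bary` as a spanning family -/

/-- The polynomial `P_α^bary` of functions. -/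
def baryFun (ℓ : ℕ) (α : Fin ℓ → ℕ) (y : ℕ → X → ℝ) : X → ℝ :=
  fun x => baryPoly ℓ α (fun j => y j x)

/-- The sequence `y_0, y_2, y_3, ...`. -/
def dropOne {Y : Type*} (y : ℕ → Y) : ℕ → Y := fun j => if j = 0 then y 0 else y (j + 1)

/-- For `j ≥ 2` neither `σ_j` nor `s_j` involves the index `1`, so removing `y_1` leaves a
polynomial of the same kind in one variable fewer. -/
theorem baryFun_cons (ℓ a : ℕ) (α : Fin ℓ → ℕ) (y : ℕ → X → ℝ) :
    baryFun (ℓ + 1) (Fin.cons a α) y =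
      jacobiFun (2 * (∑ m, α m) + 2 * ℓ + 1) 1 a (y 1) (∑ j ∈ Finset.range (ℓ + 2), y j) *
        baryFun ℓ α (dropOne y) := by
  ext x
  simp only [baryFun, baryPoly, Fin.prod_univ_succ, Pi.mul_apply]
  congr 1
  · simp only [jacobiFun]
    congr 1
    · simp [Fin.Ioi_zero_eq_map]
    · rw [Finset.sum_apply, Finset.range_eq_Ico, Finset.sum_eq_sum_Ico_succ_bot (by omega)]
      rfl
  · refine Finset.prod_congr rfl fun j _ => ?_
    congr 1
    · have h : ∑ m ∈ Finset.Ioi j.succ, (Fin.cons a α : Fin (ℓ + 1) → ℕ) m =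
          ∑ m ∈ Finset.Ioi j, α m := by
        rw [← Fin.map_succEmb_Ioi, Finset.sum_map]
        simp
      simp only [h, Fin.val_succ]
      omega
    · rw [Fin.val_succ, ← Finset.map_add_right_Icc _ _ 1, Finset.sum_map]
      simp only [dropOne, if_true]
      congr 1
      refine Finset.sum_congr rfl fun m hm => ?_
      rw [if_neg (by have := (Finset.mem_Icc.1 hm).1; omega)]
      rfl

/-- The span of the polynomials `(∑ y_j) ^ e * P_α^bary (y_0, ..., y_ℓ)`, `e + |α| = n`. -/
def barySpan (ℓ n : ℕ) (y : ℕ → X → ℝ) : Submodule ℝ (X → ℝ) :=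
  Submodule.span ℝ {f | ∃ (e : ℕ) (α : Fin ℓ → ℕ), e + ∑ j, α j = n ∧
    f = (∑ j ∈ Finset.range (ℓ + 1), y j) ^ e * baryFun ℓ α y}

theorem image_dropOne (ℓ : ℕ) (y : ℕ → X → ℝ) :
    y '' {j | j < ℓ + 2} = insert (y 1) (dropOne y '' {j | j < ℓ + 1}) := by
  ext f
  constructor
  · rintro ⟨j, hj, rfl⟩
    rcases j with _ | _ | j
    · exact Or.inr ⟨0, by simp, rfl⟩
    · exact Or.inl rfl
    · exact Or.inr ⟨j + 1, by simp only [Set.mem_ofPred_eq] at hj ⊢; omega, rfl⟩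
  · rintro (rfl | ⟨j, hj, rfl⟩)
    · exact ⟨1, by simp, rfl⟩
    · simp only [Set.mem_ofPred_eq] at hj
      rcases j with _ | j
      · exact ⟨0, by simp, rfl⟩
      · exact ⟨j + 2, by simp only [Set.mem_ofPred_eq]; omega, rfl⟩

theorem sum_dropOne (ℓ : ℕ) (y : ℕ → X → ℝ) :
    ∑ j ∈ Finset.range (ℓ + 1), dropOne y j = ∑ j ∈ Finset.range (ℓ + 2), y j - y 1 := by
  rw [Finset.sum_range_succ', Finset.sum_range_succ' _ (ℓ + 1), Finset.sum_range_succ' _ ℓ]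
  simp [dropOne]
  ring

/-- Expand in powers of `y_1`. By induction the cofactor is a combination of `(s - y_1) ^ r * P_α`
with `s = ∑ y_j`. Then `y_1 ^ e * (s - y_1) ^ r` is homogeneous in `(y_1, s)` and can be rewritten
with the Jacobi parameter that `α` prescribes. -/
theorem span_pow_le_barySpan (ℓ n : ℕ) (y : ℕ → X → ℝ) :
    (Submodule.span ℝ (y '' {j | j < ℓ + 1})) ^ n ≤ barySpan ℓ n y := by
  induction ℓ generalizing n y with
  | zero =>
    have : y '' {j | j < 0 + 1} = {y 0} := by
      rw [show {j | j < 0 + 1} = ({0} : Set ℕ) by ext; simp, Set.image_singleton]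
    rw [this, Submodule.span_pow, Set.singleton_pow, Submodule.span_le]
    rintro _ rfl
    refine Submodule.subset_span ⟨n, Fin.elim0, by simp, ?_⟩
    ext x
    simp [baryFun, baryPoly]
  | succ ℓ ih =>
    rw [image_dropOne, Submodule.span_insert]
    refine sup_pow_le _ _ _ _ fun e f hef => (_root_.mul_le_mul' le_rfl (ih f (dropOne y))).trans ?_
    rw [barySpan, Submodule.span_pow, Set.singleton_pow, Submodule.span_mul_span, Submodule.span_le]
    rintro _ ⟨_, rfl, _, ⟨r, α, hr, rfl⟩, rfl⟩
    set s := ∑ j ∈ Finset.range (ℓ + 2), y j with hs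
    set a := 2 * (∑ m, α m) + 2 * ℓ + 1 with ha
    have h1 : y 1 ^ e * (s - y 1) ^ r ∈ jacobiSpan a 1 (e + r) (y 1) s := by
      refine span_pair_pow_le _ _ _ _ _ ?_
      have hy : y 1 ∈ Submodule.span ℝ {y 1, s} := Submodule.subset_span (by simp)
      have hs : s ∈ Submodule.span ℝ {y 1, s} := Submodule.subset_span (by simp)
      rw [pow_add]
      exact Submodule.mul_mem_mul (Submodule.pow_mem_pow _ hy e)
        (Submodule.pow_mem_pow _ (Submodule.sub_mem _ hs hy) r)
    have h2 : jacobiSpan a 1 (e + r) (y 1) s * Submodule.span ℝ {baryFun ℓ α (dropOne y)} ≤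
        barySpan (ℓ + 1) n y := by
      rw [jacobiSpan, Submodule.span_mul_span, Submodule.span_le]
      rintro _ ⟨_, ⟨p, m, hpm, rfl⟩, _, rfl, rfl⟩
      refine Submodule.subset_span ⟨p, Fin.cons m α, ?_, ?_⟩
      · simp only [Fin.sum_cons]
        omega
      · rw [baryFun_cons, ← mul_assoc]
    have := h2 (Submodule.mul_mem_mul h1 (Submodule.mem_span_singleton_self _))
    rw [hs, ← sum_dropOne, mul_assoc] at this
    exact this

theorem baryFun_mem_pow (ℓ : ℕ) (α : Fin ℓ → ℕ) (y : ℕ → X → ℝ) {V : Submodule ℝ (X → ℝ)}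
    (hy : ∀ j ≤ ℓ, y j ∈ V) : baryFun ℓ α y ∈ V ^ ∑ j, α j := by
  have : baryFun ℓ α y = ∏ j : Fin ℓ,
      jacobiFun (2 * (∑ m ∈ Finset.Ioi j, α m) + 2 * (ℓ - (j.val + 1)) + 1) 1 (α j)
        (y (j.val + 1)) (y 0 + ∑ m ∈ Finset.Icc (j.val + 1) ℓ, y m) := by
    ext x
    simp [baryFun, baryPoly, jacobiFun]
  rw [this]
  refine prod_mem_pow_card _ _ _ _ fun j _ => jacobiFun_mem_pow _ _ _ (hy _ j.2) ?_
  exact V.add_mem (hy 0 (Nat.zero_le _))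
    (Submodule.sum_mem _ fun m hm => hy m (Finset.mem_Icc.1 hm).2)

/-! ### Orthogonality of Jacobi polynomials -/

/-- Up to signs this is the `k`-th finite difference of a polynomial in `m` of degree at most `i + j
< k`. -/
theorem sum_choose_mul_factorial_eq_zero (b k i j : ℕ) (hij : i + j < k) :
    ∑ m ∈ Finset.range (k + 1), (k.choose m : ℝ) * ((k + b).choose (k - m) : ℝ) *
      (-1) ^ (k - m) * ((i + (k - m)).factorial * (m + j + b).factorial) = 0 := by
  -- The quotients `(i + k - m)! / (k - m)!` and `(m + j + b)! / (m + b)!` are products of `i` and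
  -- `j` linear factors in `m`.
  let Q : Polynomial ℝ := Polynomial.C ((k + b).factorial : ℝ) *
    ((∏ l ∈ Finset.range i, (Polynomial.C (k + 1 + l : ℝ) - Polynomial.X)) *
      ∏ l ∈ Finset.range j, (Polynomial.X + Polynomial.C (b + 1 + l : ℝ)))
  have hdeg : Q.natDegree < k := by
    refine lt_of_le_of_lt ?_ hij
    refine (Polynomial.natDegree_C_mul_le _ _).trans (Polynomial.natDegree_mul_le.trans ?_)
    refine add_le_add ?_ ?_
    · refine (Polynomial.natDegree_prod_le _ _).trans ?_
      refine (Finset.sum_le_card_nsmul _ _ 1 fun l _ => ?_).trans (by simp)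
      compute_degree
    · refine (Polynomial.natDegree_prod_le _ _).trans ?_
      refine (Finset.sum_le_card_nsmul _ _ 1 fun l _ => ?_).trans (by simp)
      compute_degree
  have hQ : ∀ m ≤ k, Q.eval (m : ℝ) = ((k + b).choose (k - m) : ℝ) *
      ((i + (k - m)).factorial * (m + j + b).factorial) := by
    intro m hm
    have h1 : ((k + b).factorial : ℝ) =
        (k + b).choose (k - m) * (k - m).factorial * (m + b).factorial := by
      have := Nat.choose_mul_factorial_mul_factorial (n := k + b) (k := k - m) (by omega)
      rw [show k + b - (k - m) = m + b by omega] at this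
      exact_mod_cast this.symm
    have h2 : ((i + (k - m)).factorial : ℝ) =
        (k - m).factorial * ∏ l ∈ Finset.range i, ((k : ℝ) + 1 + l - m) := by
      have := Nat.factorial_mul_ascFactorial (k - m) i
      rw [Nat.ascFactorial_eq_prod_range] at this
      rw [add_comm i, ← this]
      push_cast [Nat.cast_sub hm]
      congr 1
      exact Finset.prod_congr rfl fun l _ => by ring
    have h3 : ((m + j + b).factorial : ℝ) =
        (m + b).factorial * ∏ l ∈ Finset.range j, ((m : ℝ) + (b + 1 + l)) := by
      have := Nat.factorial_mul_ascFactorial (m + b) j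
      rw [Nat.ascFactorial_eq_prod_range] at this
      rw [show m + j + b = m + b + j by ring, ← this]
      push_cast
      congr 1
      exact Finset.prod_congr rfl fun l _ => by ring
    simp only [Q, Polynomial.eval_mul, Polynomial.eval_prod, Polynomial.eval_C,
      Polynomial.eval_sub, Polynomial.eval_add, Polynomial.eval_X]
    rw [h1, h2, h3]
    ring
  have h := congrFun (Polynomial.fwdDiff_iter_eq_zero_of_degree_lt hdeg) 0
  rw [fwdDiff_iter_eq_sum_shift] at h
  simp only [zero_add, nsmul_eq_mul, mul_one, zsmul_eq_mul, Pi.zero_apply] at h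
  rw [← h]
  refine Finset.sum_congr rfl fun m hm => ?_
  rw [hQ m (Nat.lt_succ_iff.mp (Finset.mem_range.mp hm))]
  push_cast
  ring

variable [MeasurableSpace X]

/-- The moments of a function whose distribution function is a power. -/
theorem integral_pow_of_measure_le {ν : Measure X} [IsFiniteMeasure ν] {r : X → ℝ}
    (hr : Measurable r) (h0 : ∀ᵐ x ∂ν, 0 ≤ r x ∧ r x ≤ 1) {c : ℕ} (hc : 0 < c)
    (h : ∀ s, 0 < s → s ≤ 1 → ν.real {x | r x ≤ s} = s ^ c * ν.real Set.univ) (n : ℕ) :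
    ∫ x, r x ^ n ∂ν = c / (n + c) * ν.real Set.univ := by
  -- The case `n = 0` is separate because the layer-cake formula below takes `n`-th roots.
  rcases Nat.eq_zero_or_pos n with rfl | hn
  · have : (c : ℝ) ≠ 0 := by positivity
    simp [this]
  have hint : Integrable (fun x => r x ^ n) ν := by
    refine Integrable.of_bound (hr.pow_const n).aestronglyMeasurable 1 ?_
    filter_upwards [h0] with x hx
    rw [Real.norm_of_nonneg (pow_nonneg hx.1 n)]
    exact pow_le_one₀ hx.1 hx.2
  rw [hint.integral_eq_integral_meas_lt (by filter_upwards [h0] with x hx using pow_nonneg hx.1 n)]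
  set M := ν.real Set.univ
  have hn' : (n : ℝ) ≠ 0 := by positivity
  have hlt : ∀ t : ℝ, 0 < t → t < 1 →
      ν.real {x | t < r x ^ n} = M - t ^ ((c : ℝ) / n) * M := by
    intro t ht0 ht1
    have hs0 : 0 < t ^ ((n : ℝ)⁻¹) := Real.rpow_pos_of_pos ht0 _
    have hs1 : t ^ ((n : ℝ)⁻¹) ≤ 1 := Real.rpow_le_one ht0.le ht1.le (by positivity)
    have hsn : (t ^ ((n : ℝ)⁻¹)) ^ n = t := Real.rpow_inv_natCast_pow ht0.le hn.ne'
    have e1 : ν.real {x | t < r x ^ n} = ν.real {x | r x ≤ t ^ ((n : ℝ)⁻¹)}ᶜ := by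
      refine measureReal_congr ?_
      filter_upwards [h0] with x hx
      refine propext ?_
      change t < r x ^ n ↔ ¬ r x ≤ t ^ ((n : ℝ)⁻¹)
      rw [not_le]
      nth_rw 1 [← hsn]
      exact pow_lt_pow_iff_left₀ hs0.le hx.1 hn.ne'
    rw [e1, measureReal_compl (measurableSet_le hr measurable_const), h _ hs0 hs1,
      ← Real.rpow_natCast, ← Real.rpow_mul ht0.le]
    congr 3
    field_simp
  have hge : ∀ t : ℝ, 1 ≤ t → ν.real {x | t < r x ^ n} = 0 := by
    intro t ht
    have : ν.real {x | t < r x ^ n} = ν.real (∅ : Set X) := by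
      refine measureReal_congr ?_
      filter_upwards [h0] with x hx
      refine propext ⟨fun hx' => ?_, fun hx' => hx'.elim⟩
      have h1 : r x ^ n ≤ 1 := pow_le_one₀ hx.1 hx.2
      have h2 : t < r x ^ n := hx'
      linarith
    rw [this, measureReal_empty]
  have hsplit : ∫ t in Set.Ioi (0 : ℝ), ν.real {x | t < r x ^ n} =
      ∫ t in Set.Ioo (0 : ℝ) 1, ν.real {x | t < r x ^ n} := by
    refine (setIntegral_eq_of_subset_of_forall_sdiff_eq_zero measurableSet_Ioi
      Set.Ioo_subset_Ioi_self fun t ht => hge t ?_)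
    by_contra h1
    exact ht.2 ⟨ht.1, not_le.1 h1⟩
  rw [hsplit, setIntegral_congr_fun measurableSet_Ioo fun t ht => hlt t ht.1 ht.2,
    ← integral_Ioc_eq_integral_Ioo, ← intervalIntegral.integral_of_le zero_le_one,
    intervalIntegral.integral_sub (by simp)
      ((intervalIntegral.intervalIntegrable_rpow' (by
        have : (0 : ℝ) ≤ c / n := by positivity
        linarith)).mul_const M),
    intervalIntegral.integral_mul_const, integral_rpow (Or.inl (by
        have : (0 : ℝ) ≤ c / n := by positivity
        linarith))]
  have h1 : (c : ℝ) / n + 1 ≠ 0 := by positivity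
  have h2 : (n : ℝ) + c ≠ 0 := by positivity
  rw [Real.one_rpow, Real.zero_rpow h1]
  simp
  field_simp
  ring

/-- After normalization `r` has density `(c + 1) s ^ c` on `[0, 1]`, so this is `(c + 1) B(a + 1, n
+ c + 1)`. The recursion in `a` avoids the Beta function. -/
theorem integral_one_sub_pow_mul_pow {ν : Measure X} [IsFiniteMeasure ν] {r : X → ℝ}
    (hr : Measurable r) (h0 : ∀ᵐ x ∂ν, 0 ≤ r x ∧ r x ≤ 1) {c : ℕ}
    (h : ∀ s, 0 < s → s ≤ 1 → ν.real {x | r x ≤ s} = s ^ (c + 1) * ν.real Set.univ) (a n : ℕ) :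
    ∫ x, (1 - r x) ^ a * r x ^ n ∂ν =
      (c + 1) * (a.factorial * (n + c).factorial) / (n + c + 1 + a).factorial *
        ν.real Set.univ := by
  induction a generalizing n with
  | zero =>
    simp only [pow_zero, one_mul]
    rw [integral_pow_of_measure_le hr h0 c.succ_pos h n]
    congr 1
    rw [add_zero, Nat.factorial_succ]
    have := Nat.factorial_ne_zero (n + c)
    push_cast
    field_simp
    simp
    ring
  | succ a ih =>
    have hint : ∀ n, Integrable (fun x => (1 - r x) ^ a * r x ^ n) ν := fun n => by
      refine Integrable.of_bound
        (((measurable_const.sub hr).pow_const a).mul (hr.pow_const n)).aestronglyMeasurable 1 ?_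
      filter_upwards [h0] with x hx
      rw [Real.norm_of_nonneg (mul_nonneg (pow_nonneg (by linarith) _) (pow_nonneg hx.1 n))]
      exact mul_le_one₀ (pow_le_one₀ (by linarith) (by linarith)) (pow_nonneg hx.1 n)
        (pow_le_one₀ hx.1 hx.2)
    have e : ∀ x, (1 - r x) ^ (a + 1) * r x ^ n =
        (1 - r x) ^ a * r x ^ n - (1 - r x) ^ a * r x ^ (n + 1) := fun x => by ring
    simp only [e]
    rw [integral_sub (hint n) (hint (n + 1)), ih, ih]
    rw [← sub_mul]
    congr 1
    rw [show n + 1 + c + 1 + a = n + c + 1 + a + 1 by ring,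
      show n + c + 1 + (a + 1) = n + c + 1 + a + 1 by ring, show n + 1 + c = n + c + 1 by ring,
      Nat.factorial_succ (n + c + 1 + a), Nat.factorial_succ (n + c), Nat.factorial_succ a]
    have := Nat.factorial_ne_zero (n + c + 1 + a)
    push_cast
    field_simp
    ring

/-- In terms of `r` the Jacobi polynomial is a signed sum of `(1 - r) ^ (k - m) * r ^ m`. The
resulting Beta integrals share one denominator, because the total exponent does not depend on `m`;
the numerators then cancel as a finite difference. -/
theorem integral_one_sub_pow_mul_jacobi {ν : Measure X} [IsFiniteMeasure ν] {r : X → ℝ}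
    (hr : Measurable r) (h0 : ∀ᵐ x ∂ν, 0 ≤ r x ∧ r x ≤ 1) {b k i j : ℕ} (hij : i + j < k)
    (h : ∀ s, 0 < s → s ≤ 1 → ν.real {x | r x ≤ s} = s ^ (j + b + 1) * ν.real Set.univ) :
    ∫ x, (1 - r x) ^ i * jacobi 0 b k (1 - 2 * (1 - r x)) ∂ν = 0 := by
  have hint : ∀ a n, Integrable (fun x => (1 - r x) ^ a * r x ^ n) ν := fun a n => by
    refine Integrable.of_bound
      (((measurable_const.sub hr).pow_const a).mul (hr.pow_const n)).aestronglyMeasurable 1 ?_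
    filter_upwards [h0] with x hx
    rw [Real.norm_of_nonneg (mul_nonneg (pow_nonneg (by linarith) _) (pow_nonneg hx.1 n))]
    exact mul_le_one₀ (pow_le_one₀ (by linarith) (by linarith)) (pow_nonneg hx.1 n)
      (pow_le_one₀ hx.1 hx.2)
  have e : ∀ x, (1 - r x) ^ i * jacobi 0 b k (1 - 2 * (1 - r x)) =
      ∑ m ∈ Finset.range (k + 1), ((k.choose m : ℝ) * ((k + b).choose (k - m) : ℝ) *
        (-1) ^ (k - m)) * ((1 - r x) ^ (i + (k - m)) * r x ^ m) := fun x => by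
    unfold jacobi
    rw [Finset.mul_sum]
    refine Finset.sum_congr rfl fun m _ => ?_
    rw [show (1 - 2 * (1 - r x) - 1) / 2 = (-1) * (1 - r x) by ring,
      show (1 - 2 * (1 - r x) + 1) / 2 = r x by ring, mul_pow, pow_add, add_zero]
    ring
  simp only [e]
  rw [integral_finsetSum _ fun m _ => (hint _ _).const_mul _]
  have e2 : ∀ m ∈ Finset.range (k + 1), ∫ x, ((k.choose m : ℝ) * ((k + b).choose (k - m) : ℝ) *
        (-1) ^ (k - m)) * ((1 - r x) ^ (i + (k - m)) * r x ^ m) ∂ν =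
      ((k.choose m : ℝ) * ((k + b).choose (k - m) : ℝ) *
      (-1) ^ (k - m) * ((i + (k - m)).factorial * (m + j + b).factorial)) *
        (((j + b : ℕ) + 1) / (k + j + b + 1 + i).factorial * ν.real Set.univ) := fun m hm => by
    have hm' : m ≤ k := Nat.lt_succ_iff.mp (Finset.mem_range.mp hm)
    rw [integral_const_mul, integral_one_sub_pow_mul_pow hr h0 h,
      show m + (j + b) + 1 + (i + (k - m)) = k + j + b + 1 + i by omega,
      show m + (j + b) = m + j + b by ring]
    ring
  rw [Finset.sum_congr rfl e2, ← Finset.sum_mul, sum_choose_mul_factorial_eq_zero b k i j hij,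
    zero_mul]

namespace SimplicialMesh

variable {d : ℕ} {Ω : Set (Pt d)} {T : SimplicialMesh Ω}

/-! ### Facets in barycentric coordinates -/

theorem continuous_bary (K : T.Cell) (z : Pt d) : Continuous (T.bary K z) :=
  (T.bary K z).continuous_of_finiteDimensional

theorem mem_simplex_iff (K : T.Cell) {s : Finset (Pt d)} (hs : s ⊆ K.1) {x : Pt d} :
    x ∈ simplex s ↔ (∀ z ∈ s, 0 ≤ T.bary K z x) ∧ ∀ z ∈ K.1, z ∉ s → T.bary K z x = 0 := by
  constructor
  · intro hx
    have hxK : x ∈ simplex K.1 := convexHull_mono (Finset.coe_subset.2 hs) hx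
    exact ⟨fun z _ => bary_nonneg K z hxK,
      fun z _ hz => bary_eq_zero K z (Finset.coe_subset.2 hs) (by simpa using hz) hx⟩
  · rintro ⟨h0, h1⟩
    refine mem_simplex_of_bary K s hs x (fun z hz => ?_) h1
    by_cases h : z ∈ s
    · exact h0 z h
    · exact (h1 z hz h).ge

theorem sum_bary_of_mem (K : T.Cell) {s : Finset (Pt d)} (hs : s ⊆ K.1) {x : Pt d}
    (hx : x ∈ simplex s) : ∑ z ∈ s, T.bary K z x = 1 := by
  rw [Finset.sum_subset hs ((mem_simplex_iff K hs).1 hx).2, sum_bary]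

theorem sum_bary_smul_of_mem (K : T.Cell) {s : Finset (Pt d)} (hs : s ⊆ K.1) {x : Pt d}
    (hx : x ∈ simplex s) : ∑ z ∈ s, T.bary K z x • z = x := by
  rw [Finset.sum_subset hs fun z hz hzs => by
    rw [((mem_simplex_iff K hs).1 hx).2 z hz hzs, zero_smul], sum_bary_smul]

theorem bary_le_one (K : T.Cell) {s : Finset (Pt d)} (hs : s ⊆ K.1) {x : Pt d}
    (hx : x ∈ simplex s) {z : Pt d} (hz : z ∈ s) : T.bary K z x ≤ 1 := by
  rw [← sum_bary_of_mem K hs hx]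
  exact Finset.single_le_sum (f := fun z => T.bary K z x)
    (fun w hw => ((mem_simplex_iff K hs).1 hx).1 w hw) hz

theorem bary_homothety_self (K : T.Cell) {z : Pt d} (hz : z ∈ K.1) (s : ℝ) (x : Pt d) :
    T.bary K z (AffineMap.homothety z s x) = 1 - s + s * T.bary K z x := by
  classical
  rw [AffineMap.homothety_eq_lineMap, AffineMap.apply_lineMap, AffineMap.lineMap_apply_module,
    bary_vertex K z z hz]
  simp

theorem bary_homothety_of_ne (K : T.Cell) {z w : Pt d} (hz : z ∈ K.1) (hwz : w ≠ z) (s : ℝ)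
    (x : Pt d) : T.bary K w (AffineMap.homothety z s x) = s * T.bary K w x := by
  classical
  rw [AffineMap.homothety_eq_lineMap, AffineMap.apply_lineMap, AffineMap.lineMap_apply_module,
    bary_vertex K w z hz, if_neg hwz]
  simp

/-- A homothety centred at `z` multiplies `1 - λ_z` and every other barycentric coordinate by `s`.
-/
theorem homothety_image_simplex (K : T.Cell) {F : Finset (Pt d)} (hF : F ⊆ K.1) {z : Pt d}
    (hz : z ∈ F) {s : ℝ} (hs0 : 0 < s) (hs1 : s ≤ 1) :
    AffineMap.homothety z s '' simplex F = {x | 1 - T.bary K z x ≤ s} ∩ simplex F := by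
  have hzK := hF hz
  ext x
  constructor
  · rintro ⟨y, hy, rfl⟩
    have hy' := (mem_simplex_iff K hF).1 hy
    refine ⟨?_, (mem_simplex_iff K hF).2 ⟨fun w hw => ?_, fun w hw hwF => ?_⟩⟩
    · have := hy'.1 z hz
      simp only [Set.mem_ofPred_eq, bary_homothety_self K hzK]
      nlinarith
    · rcases eq_or_ne w z with rfl | h
      · rw [bary_homothety_self K hzK]
        have := mul_nonneg hs0.le (hy'.1 w hw)
        linarith
      · rw [bary_homothety_of_ne K hzK h]
        exact mul_nonneg hs0.le (hy'.1 w hw)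
    · have h : w ≠ z := fun e => hwF (e ▸ hz)
      rw [bary_homothety_of_ne K hzK h, hy'.2 w hw hwF, mul_zero]
  · rintro ⟨hxs, hx⟩
    have hx' := (mem_simplex_iff K hF).1 hx
    refine ⟨AffineMap.homothety z s⁻¹ x, (mem_simplex_iff K hF).2 ⟨fun w hw => ?_,
      fun w hw hwF => ?_⟩, ?_⟩
    · rcases eq_or_ne w z with rfl | h
      · rw [bary_homothety_self K hzK]
        have h1 : 1 - T.bary K w x ≤ s := hxs
        have h2 : s⁻¹ * (1 - T.bary K w x) ≤ 1 := by
          rw [inv_mul_le_iff₀ hs0]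
          linarith
        linarith
      · rw [bary_homothety_of_ne K hzK h]
        exact mul_nonneg (inv_nonneg.2 hs0.le) (hx'.1 w hw)
    · have h : w ≠ z := fun e => hwF (e ▸ hz)
      rw [bary_homothety_of_ne K hzK h, hx'.2 w hw hwF, mul_zero]
    · rw [← AffineMap.homothety_mul_apply, mul_inv_cancel₀ hs0.ne', AffineMap.homothety_one]
      rfl

/-! ### The surface measure of a facet -/

/-- The facet lies in a Lipschitz image of the unit cube of dimension `d - 1`, parametrized by the
coordinates of the vertices other than one chosen `z`. -/
theorem euclideanHausdorffMeasure_simplex_lt_top (K : T.Cell) (F : Finset (Pt d))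
    (hF : F ⊆ K.1) (hcard : F.card = d) (hd : 0 < d) : μHE[d - 1] (simplex F) < ⊤ := by
  classical
  obtain ⟨z, hz⟩ : F.Nonempty := Finset.card_pos.1 (by omega)
  let ι : Type := F.erase z
  have hι : Fintype.card ι = d - 1 := by
    simp [ι, Finset.card_erase_of_mem hz, hcard]
  let L : (ι → ℝ) →ₗ[ℝ] Pt d := ∑ i : ι, (LinearMap.proj i).smulRight (i.1 - z)
  let ψ : (ι → ℝ) → Pt d := fun c => z + L.toContinuousLinearMap c
  have hψ : LipschitzWith ‖L.toContinuousLinearMap‖₊ ψ :=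
    (isometry_add_left z).lipschitz.comp L.toContinuousLinearMap.lipschitz |>.weaken (by simp)
  have hsub : simplex F ⊆ ψ '' Set.Icc 0 1 := by
    intro x hx
    have hx' := (mem_simplex_iff K hF).1 hx
    refine ⟨fun i => T.bary K i.1 x, ⟨fun i => hx'.1 _ (Finset.mem_of_mem_erase i.2),
      fun i => bary_le_one K hF hx (Finset.mem_of_mem_erase i.2)⟩, ?_⟩
    have h1 : ∑ w ∈ F, T.bary K w x • (w - z) = x - z := by
      simp only [smul_sub, Finset.sum_sub_distrib, ← Finset.sum_smul, sum_bary_of_mem K hF hx,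
        sum_bary_smul_of_mem K hF hx, one_smul]
    have h2 : L (fun i => T.bary K i.1 x) = ∑ w ∈ F, T.bary K w x • (w - z) := by
      rw [← Finset.sum_erase_add _ _ hz, sub_self, smul_zero, add_zero, ← Finset.sum_coe_sort]
      simp [L, ι]
    simp only [ψ, LinearMap.coe_toContinuousLinearMap', h2, h1]
    abel
  refine (measure_mono hsub).trans_lt ?_
  rw [Measure.euclideanHausdorffMeasure_def, Measure.smul_apply]
  refine ENNReal.mul_lt_top (by simp) ?_
  refine (hψ.hausdorffMeasure_image_le (by positivity) _).trans_lt ?_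
  rw [← hι, hausdorffMeasure_pi_real]
  exact ENNReal.mul_lt_top (by simp) isCompact_Icc.measure_lt_top

theorem restrict_homothety_image (n : ℕ) (z : Pt d) {s : ℝ} (hs : 0 < s) (S : Set (Pt d)) :
    (μHE[n]).restrict (AffineMap.homothety z s '' S) =
      ENNReal.ofReal (s ^ n) • ((μHE[n]).restrict S).map (AffineMap.homothety z s) := by
  have hm : Measurable (AffineMap.homothety z s : Pt d → Pt d) :=
    (AffineMap.homothety_continuous z s).measurable
  ext t ht
  rw [Measure.restrict_apply ht, Measure.smul_apply, Measure.map_apply hm ht,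
    Measure.restrict_apply (hm ht), Set.inter_comm, ← Set.image_inter_preimage,
    Set.inter_comm, euclideanHausdorffMeasure_homothety_image n z hs.ne', ENNReal.smul_def,
    smul_eq_mul, smul_eq_mul, ENNReal.coe_pow, ENNReal.ofReal_pow hs.le, ← enorm_eq_nnnorm,
    Real.enorm_of_nonneg hs.le]

theorem measurableSet_simplex (s : Finset (Pt d)) : MeasurableSet (simplex s) :=
  (isClosed_simplex s).measurableSet

/-! ### Jacobi integrals with conical weights -/

/-- A weight that is homogeneous of degree `j` with respect to the homotheties with centre `z`. -/
structure IsConical (F : Finset (Pt d)) (z : Pt d) (j : ℕ) (G : Pt d → ℝ) :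
    Prop where
  continuous : Continuous G
  nonneg : ∀ x ∈ simplex F, 0 ≤ G x
  map_homothety : ∀ (s : ℝ) (x : Pt d), G (AffineMap.homothety z s x) = s ^ j * G x

open scoped Pointwise in
theorem isConical_of_mem_pow (K : T.Cell) {F : Finset (Pt d)} (hF : F ⊆ K.1) {z : Pt d}
    (hz : z ∈ F) (j : ℕ) {G : Pt d → ℝ}
    (hG : G ∈ ((fun w x => T.bary K w x) '' (F.erase z : Set (Pt d)) : Set (Pt d → ℝ)) ^ j) :
    IsConical F z j G := by
  induction j generalizing G with
  | zero =>
    rw [pow_zero, Set.mem_one] at hG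
    subst hG
    exact ⟨continuous_one, fun _ _ => zero_le_one, fun _ _ => by simp⟩
  | succ j ih =>
    rw [pow_succ', Set.mem_mul] at hG
    obtain ⟨_, ⟨w, hw, rfl⟩, H, hH, rfl⟩ := hG
    have hw' := Finset.mem_erase.1 (Finset.mem_coe.1 hw)
    have h := ih hH
    refine ⟨(continuous_bary K w).mul h.continuous, fun x hx => ?_, fun s x => ?_⟩
    · exact mul_nonneg (((mem_simplex_iff K hF).1 hx).1 w hw'.2) (h.nonneg x hx)
    · simp only [Pi.mul_apply, h.map_homothety, bary_homothety_of_ne K (hF hz) hw'.1]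
      ring

/-- Change of variables by the homothety with ratio `s`: the weight contributes `s ^ j` and the
surface measure `s ^ n`. -/
theorem measure_conical (K : T.Cell) {F : Finset (Pt d)} (hF : F ⊆ K.1) {z : Pt d}
    (hz : z ∈ F) {j n : ℕ} {G : Pt d → ℝ} (hG : IsConical F z j G) {s : ℝ} (hs0 : 0 < s)
    (hs1 : s ≤ 1) :
    (((μHE[n]).restrict (simplex F)).withDensity fun x => ENNReal.ofReal (G x)).real
      {x | 1 - T.bary K z x ≤ s} = s ^ (j + n) *
    (((μHE[n]).restrict (simplex F)).withDensity fun x => ENNReal.ofReal (G x)).real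
      Set.univ := by
  have hm : MeasurableSet {x : Pt d | 1 - T.bary K z x ≤ s} :=
    measurableSet_le (measurable_const.sub (continuous_bary K z).measurable) measurable_const
  have hh : Measurable (AffineMap.homothety z s : Pt d → Pt d) :=
    (AffineMap.homothety_continuous z s).measurable
  have hGm : Measurable fun x => ENNReal.ofReal (G x) := hG.continuous.measurable.ennreal_ofReal
  rw [Measure.real, Measure.real, withDensity_apply _ hm, withDensity_apply _ MeasurableSet.univ,
    Measure.restrict_restrict hm, Measure.restrict_univ,
    ← homothety_image_simplex K hF hz hs0 hs1, restrict_homothety_image n z hs0,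
    lintegral_smul_measure, lintegral_map hGm hh]
  simp only [hG.map_homothety, ENNReal.ofReal_mul (pow_nonneg hs0.le j)]
  rw [lintegral_const_mul _ hGm, smul_eq_mul, ENNReal.toReal_mul, ENNReal.toReal_mul,
    ENNReal.toReal_ofReal (by positivity), ENNReal.toReal_ofReal (by positivity), pow_add]
  ring

theorem integrableOn_simplex (K : T.Cell) {F : Finset (Pt d)} (hF : F ⊆ K.1)
    (hcard : F.card = d) (hd : 0 < d) {f : Pt d → ℝ} (hf : Continuous f) :
    IntegrableOn f (simplex F) μHE[d - 1] := by
  have hc : IsCompact (simplex F) := F.finite_toSet.isCompact_convexHull ℝ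
  obtain ⟨C, hC⟩ := hc.exists_bound_of_continuousOn hf.continuousOn
  exact IntegrableOn.of_bound (euclideanHausdorffMeasure_simplex_lt_top K F hF hcard hd)
    hf.aestronglyMeasurable C (ae_restrict_of_forall_mem (measurableSet_simplex F) hC)

theorem continuous_jacobi (a b n : ℕ) : Continuous (jacobi a b n) := by
  unfold jacobi
  fun_prop

/-- Taking `G` as a density makes the distribution function of `1 - λ_z` a pure power, which is all
the one-dimensional orthogonality needs. -/
theorem integral_conical_mul_jacobi (K : T.Cell) {F : Finset (Pt d)} (hF : F ⊆ K.1)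
    (hcard : F.card = d) (hd : 2 ≤ d) {z : Pt d} (hz : z ∈ F) {i j k : ℕ} (hij : i + j < k)
    {G : Pt d → ℝ} (hG : IsConical F z j G) :
    ∫ x in simplex F, jacobi 0 (d - 2) k (1 - 2 * T.bary K z x) * (T.bary K z x ^ i * G x)
      ∂μHE[d - 1] = 0 := by
  set μ : Measure (Pt d) := (μHE[d - 1]).restrict (simplex F) with hμ
  set ν := μ.withDensity fun x => ENNReal.ofReal (G x) with hν
  have hint : Integrable G μ := integrableOn_simplex K hF hcard (by omega) hG.continuous
  have hfin : IsFiniteMeasure ν := isFiniteMeasure_withDensity_ofReal hint.2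
  have hr : Measurable fun x => 1 - T.bary K z x :=
    measurable_const.sub (continuous_bary K z).measurable
  have h0 : ∀ᵐ x ∂ν, 0 ≤ 1 - T.bary K z x ∧ 1 - T.bary K z x ≤ 1 := by
    refine (withDensity_absolutelyContinuous μ _).ae_le ?_
    refine ae_restrict_of_forall_mem (measurableSet_simplex F) fun x hx => ?_
    have h1 := bary_le_one K hF hx hz
    have h2 := ((mem_simplex_iff K hF).1 hx).1 z hz
    exact ⟨by linarith, by linarith⟩
  have h := integral_one_sub_pow_mul_jacobi (b := d - 2) hr h0 hij fun s hs0 hs1 => by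
    -- The Jacobi parameter `d - 2` is one less than the dimension of the facet, which is what makes
    -- the exponents match.
    rw [show j + (d - 2) + 1 = j + (d - 1) by omega]
    exact measure_conical K hF hz hG hs0 hs1
  have e : ν = μ.withDensity fun x => ((G x).toNNReal : ENNReal) := rfl
  rw [e, integral_withDensity_eq_integral_smul hG.continuous.measurable.real_toNNReal] at h
  rw [← h]
  refine setIntegral_congr_fun (measurableSet_simplex F) fun x hx => ?_
  simp only [sub_sub_cancel, NNReal.smul_def, Real.coe_toNNReal _ (hG.nonneg x hx), smul_eq_mul]
  ring

/-! ### Orthogonality on a facet -/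

/-- The span of the hat functions of the vertices in `τ`. -/
def baryMod (K : T.Cell) (τ : Finset (Pt d)) : Submodule ℝ (Pt d → ℝ) :=
  Submodule.span ℝ ((fun z x => T.bary K z x) '' (τ : Set (Pt d)))

theorem bary_mem_baryMod (K : T.Cell) {τ : Finset (Pt d)} {z : Pt d} (hz : z ∈ τ) :
    (fun x => T.bary K z x) ∈ baryMod K τ := Submodule.subset_span ⟨z, hz, rfl⟩

theorem baryMod_mono (K : T.Cell) {τ σ : Finset (Pt d)} (h : τ ⊆ σ) :
    baryMod K τ ≤ baryMod K σ :=
  Submodule.span_mono (Set.image_mono (Finset.coe_subset.2 h))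

/-- The functions that are orthogonal to `g` on the face `F`. -/
def orthMod (F : Finset (Pt d)) (g : Pt d → ℝ) : Submodule ℝ (Pt d → ℝ) where
  carrier := {f | IntegrableOn (fun x => g x * f x) (simplex F) μHE[d - 1] ∧
    ∫ x in simplex F, g x * f x ∂μHE[d - 1] = 0}
  zero_mem' := by simp
  add_mem' := by
    rintro f f' ⟨h1, h2⟩ ⟨h1', h2'⟩
    simp only [Set.mem_ofPred_eq, Pi.add_apply, mul_add]
    refine ⟨h1.add h1', ?_⟩
    rw [integral_add h1 h1', h2, h2', add_zero]
  smul_mem' := by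
    rintro c f ⟨h1, h2⟩
    simp only [Set.mem_ofPred_eq, Pi.smul_apply, smul_eq_mul, mul_left_comm _ c]
    exact ⟨h1.const_mul c, by rw [integral_const_mul, h2, mul_zero]⟩

theorem mem_orthMod_congr {F : Finset (Pt d)} {g f f' : Pt d → ℝ} (hf : f ∈ orthMod F g)
    (h : ∀ x ∈ simplex F, f x = f' x) : f' ∈ orthMod F g := by
  have e : Set.EqOn (fun x => g x * f x) (fun x => g x * f' x) (simplex F) :=
    fun x hx => by simp only [h x hx]
  exact ⟨hf.1.congr_fun e (measurableSet_simplex F),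
    (setIntegral_congr_fun (measurableSet_simplex F) e).symm.trans hf.2⟩

/-- A monomial in the coordinates splits as `λ_z ^ i * G`, where `G` is a monomial of degree `j` in
the other coordinates and hence a conical weight. -/
theorem baryMod_pow_le_orthMod (K : T.Cell) {F : Finset (Pt d)} (hF : F ⊆ K.1)
    (hcard : F.card = d) (hd : 2 ≤ d) {z : Pt d} (hz : z ∈ F) {n k : ℕ} (hn : n < k) :
    baryMod K F ^ n ≤ orthMod F fun x => jacobi 0 (d - 2) k (1 - 2 * T.bary K z x) := by
  classical
  have e : baryMod K F = Submodule.span ℝ {fun x => T.bary K z x} ⊔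
      Submodule.span ℝ ((fun w x => T.bary K w x) '' (F.erase z : Set (Pt d))) := by
    rw [← Submodule.span_insert, baryMod]
    nth_rw 1 [← Finset.insert_erase hz]
    rw [Finset.coe_insert, Set.image_insert_eq]
  rw [e]
  refine sup_pow_le _ _ _ _ fun i j hij => ?_
  rw [Submodule.span_pow, Submodule.span_pow, Set.singleton_pow, Submodule.span_mul_span,
    Submodule.span_le]
  rintro _ ⟨_, rfl, G, hG, rfl⟩
  have hG' := isConical_of_mem_pow K hF hz j hG
  refine ⟨integrableOn_simplex K hF hcard (by omega) ?_,
    integral_conical_mul_jacobi K hF hcard hd hz (by omega) hG'⟩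
  have h1 := (continuous_jacobi 0 (d - 2) k).comp
    (continuous_const.sub (continuous_const.mul (continuous_bary K z)) :
      Continuous fun x => 1 - 2 * T.bary K z x)
  exact h1.mul (((continuous_bary K z).pow i).mul hG'.continuous)

/-- On a face, polynomials of degree at most `n` are homogeneous polynomials of degree `n` in the
barycentric coordinates. -/
theorem exists_mem_baryMod_pow (K : T.Cell) {F : Finset (Pt d)} (hF : F ⊆ K.1) {n : ℕ}
    {g : Pt d → ℝ} (hg : g ∈ polyLE d n) :
    ∃ f ∈ baryMod K F ^ n, ∀ x ∈ simplex F, g x = f x := by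
  obtain ⟨p, hp, hg⟩ := hg
  -- On `F`, `ξ i` equals the Cartesian coordinate `x i` and `s` equals `1`; powers of `s` raise
  -- every monomial to degree `n`.
  let ξ : Fin d → Pt d → ℝ := fun i => ∑ z ∈ F, z i • fun x => T.bary K z x
  let s : Pt d → ℝ := ∑ z ∈ F, fun x => T.bary K z x
  have hξ : ∀ i, ξ i ∈ baryMod K F := fun i =>
    Submodule.sum_mem _ fun z hz => Submodule.smul_mem _ _ (bary_mem_baryMod K hz)
  have hs : s ∈ baryMod K F := Submodule.sum_mem _ fun z hz => bary_mem_baryMod K hz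
  refine ⟨∑ m ∈ p.support, p.coeff m • ((∏ i, ξ i ^ m i) * s ^ (n - ∑ i, m i)),
    Submodule.sum_mem _ fun m hm => Submodule.smul_mem _ _ ?_, fun x hx => ?_⟩
  · have h1 := prod_mem_pow_card (baryMod K F) Finset.univ (fun i => m i) (fun i => ξ i ^ m i)
      fun i _ => Submodule.pow_mem_pow _ (hξ i) (m i)
    have h2 := Submodule.mul_mem_mul h1 (Submodule.pow_mem_pow _ hs (n - ∑ i, m i))
    have h3 : ∑ i, m i ≤ n := by
      have := (MvPolynomial.le_totalDegree hm).trans hp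
      rwa [Finsupp.sum_fintype _ _ fun _ => rfl] at this
    rwa [← pow_add, Nat.add_sub_cancel' h3] at h2
  · have h1 : s x = 1 := by
      simp only [s, Finset.sum_apply]
      exact sum_bary_of_mem K hF hx
    have h2 : ∀ i, ξ i x = x i := fun i => by
      have := congrArg (fun y : Pt d => y i) (sum_bary_smul_of_mem K hF hx)
      simp only [WithLp.ofLp_sum, WithLp.ofLp_smul, Finset.sum_apply, Pi.smul_apply, smul_eq_mul]
        at this
      rw [← this]
      simp only [ξ, Finset.sum_apply, Pi.smul_apply, smul_eq_mul]
      exact Finset.sum_congr rfl fun z _ => mul_comm _ _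
    rw [hg, MvPolynomial.eval_eq']
    simp [Finset.sum_apply, Finset.prod_apply, h1, h2]

/-- The Jacobi polynomial of a barycentric coordinate is orthogonal on a facet to all polynomials
of smaller degree. -/
theorem jacobi_mem_orthMod (K : T.Cell) {F : Finset (Pt d)} (hF : F ⊆ K.1)
    (hcard : F.card = d) (hd : 2 ≤ d) {z : Pt d} (hz : z ∈ F) {n k : ℕ} (hn : n < k)
    {g : Pt d → ℝ} (hg : g ∈ polyLE d n) :
    (fun x => jacobi 0 (d - 2) k (1 - 2 * T.bary K z x)) ∈ orthMod F g := by
  obtain ⟨f, hf, hfg⟩ := exists_mem_baryMod_pow K hF hg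
  have h := mem_orthMod_congr (baryMod_pow_le_orthMod K hF hcard hd hz hn hf)
    fun x hx => (hfg x hx).symm
  refine ⟨?_, ?_⟩
  · simpa only [mul_comm] using h.1
  · simpa only [mul_comm] using h.2

/-! ### The trace of the face functions on a facet -/

/-- The face bubble of `τ` on the cell `K`. -/
def bubble (K : T.Cell) (τ : Finset (Pt d)) : Pt d → ℝ := ∏ z ∈ τ, fun x => T.bary K z x

theorem faceFun_eq {k : ℕ} (A : T.Numbering) (i : T.FaceIndex k) (K : T.Cell) :
    faceFun A i K = bubble K i.face.1 *
      baryFun i.dim i.multi (fun j x => T.bary K (A.vertex i.face j) x) := by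
  ext x
  simp [faceFun, bubble, baryFun, Finset.prod_apply]

theorem image_numbering (A : T.Numbering) (K : T.Cell) (τ : T.Face) {ℓ : ℕ}
    (hτ : τ.1.card = ℓ + 1) :
    (fun z x => T.bary K z x) '' (τ.1 : Set (Pt d)) =
      (fun j x => T.bary K (A.vertex τ j) x) '' {j | j < ℓ + 1} := by
  rw [← (A.bijOn τ).image_eq, hτ, Set.image_image]

theorem sum_numbering (A : T.Numbering) (K : T.Cell) (τ : T.Face) {ℓ : ℕ}
    (hτ : τ.1.card = ℓ + 1) :
    ∑ j ∈ Finset.range (ℓ + 1), (fun x => T.bary K (A.vertex τ j) x : Pt d → ℝ) =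
      ∑ z ∈ τ.1, fun x => T.bary K z x := by
  have h := A.bijOn τ
  rw [hτ] at h
  refine Finset.sum_bij (fun j _ => A.vertex τ j) (fun j hj => ?_) (fun i hi j hj hij => ?_)
    (fun z hz => ?_) (fun _ _ => rfl)
  · exact h.mapsTo (by simpa using hj)
  · exact h.injOn (by simpa using hi) (by simpa using hj) hij
  · obtain ⟨j, hj, rfl⟩ := h.surjOn hz
    exact ⟨j, by simpa using hj, rfl⟩

/-- If `g` is orthogonal to the face functions of all faces of `F`, then it is orthogonal to all
polynomials of degree at most `k` that are divisible by the bubble of a face of `F` with at least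
two vertices. -/
theorem bubble_mul_mem_orthMod {k : ℕ} (A : T.Numbering) (K : T.Cell) {F : Finset (Pt d)}
    (hF : F ⊆ K.1) {g : Pt d → ℝ}
    (hg : ∀ i : T.FaceIndex k, i.face.1 ⊆ F → faceFun A i K ∈ orthMod F g) (n : ℕ)
    (τ : Finset (Pt d)) (hτF : τ ⊆ F) (hτ : 2 ≤ τ.card) (hn : τ.card + n ≤ k)
    (f : Pt d → ℝ) (hf : f ∈ baryMod K τ ^ n) : bubble K τ * f ∈ orthMod F g := by
  classical
  induction n using Nat.strong_induction_on generalizing τ f with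
  | _ n ih =>
  obtain ⟨ℓ, hℓ⟩ : ∃ ℓ, τ.card = ℓ + 1 := ⟨τ.card - 1, by omega⟩
  have hface : τ ∈ T.complex.faces :=
    T.complex.down_closed K.2.1 (hτF.trans hF) (Finset.card_pos.1 (by omega))
  set y : ℕ → Pt d → ℝ := fun j x => T.bary K (A.vertex ⟨τ, hface⟩ j) x with hy
  have hsum : ∑ j ∈ Finset.range (ℓ + 1), y j = ∑ z ∈ τ, fun x => T.bary K z x :=
    sum_numbering A K ⟨τ, hface⟩ hℓ
  have hyτ : ∀ j ≤ ℓ, y j ∈ baryMod K τ := fun j hj =>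
    bary_mem_baryMod K ((A.bijOn ⟨τ, hface⟩).mapsTo (by
      simp only [Set.mem_ofPred_eq]
      omega))
  suffices h : barySpan ℓ n y ≤ (orthMod F g).comap (LinearMap.mulLeft ℝ (bubble K τ)) by
    refine h (span_pow_le_barySpan ℓ n y ?_)
    rwa [baryMod, image_numbering A K ⟨τ, hface⟩ hℓ] at hf
  rw [barySpan, Submodule.span_le]
  rintro _ ⟨e, α, he, rfl⟩
  change bubble K τ * _ ∈ orthMod F g
  -- For exponent `0` the product is itself a face function. Otherwise the factor `∑_{z ∈ τ} λ_z`
  -- equals `1 - ∑_{z ∈ F \ τ} λ_z` on `F`. The `1` lowers the degree of the cofactor, and each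
  -- `λ_z` enlarges the bubble to `insert z τ`, so both terms have a cofactor of degree `n - 1`.
  rcases e with _ | e
  · rw [pow_zero, one_mul]
    have hdim : ℓ ≤ d := by
      have := Finset.card_le_card (hτF.trans hF)
      rw [K.2.2] at this
      omega
    have := hg ⟨ℓ, ⟨τ, hface⟩, α, hℓ, by omega, by
      refine le_min ?_ hdim
      omega, by omega⟩ hτF
    rwa [faceFun_eq] at this
  · set h : Pt d → ℝ := (∑ j ∈ Finset.range (ℓ + 1), y j) ^ e * baryFun ℓ α y with hh
    have hmem : h ∈ baryMod K τ ^ (n - 1) := by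
      rw [show n - 1 = e + ∑ j, α j by omega, pow_add]
      refine Submodule.mul_mem_mul (Submodule.pow_mem_pow _ (Submodule.sum_mem _ fun j hj => ?_) _)
        (baryFun_mem_pow ℓ α y hyτ)
      exact hyτ j (Nat.lt_succ_iff.1 (Finset.mem_range.1 hj))
    have h1 : bubble K τ * h ∈ orthMod F g := ih (n - 1) (by omega) τ hτF hτ (by omega) h hmem
    have h2 : ∀ z ∈ F \ τ, bubble K (insert z τ) * h ∈ orthMod F g := fun z hz => by
      have hz' := Finset.mem_sdiff.1 hz
      have hc : (insert z τ).card = τ.card + 1 := Finset.card_insert_of_notMem hz'.2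
      exact ih (n - 1) (by omega) (insert z τ) (Finset.insert_subset hz'.1 hτF) (by omega)
        (by omega) h (pow_le_pow_left' (baryMod_mono K (Finset.subset_insert z τ)) _ hmem)
    refine mem_orthMod_congr (Submodule.sub_mem _ h1 (Submodule.sum_mem _ h2)) fun x hx => ?_
    have h3 : ∑ z ∈ F \ τ, T.bary K z x + ∑ z ∈ τ, T.bary K z x = 1 := by
      rw [Finset.sum_sdiff hτF, sum_bary_of_mem K hF hx]
    have h4 : ∑ z ∈ F \ τ, (bubble K (insert z τ) * h) x =
        (∑ z ∈ F \ τ, T.bary K z x) * (bubble K τ x * h x) := by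
      rw [Finset.sum_mul]
      refine Finset.sum_congr rfl fun z hz => ?_
      rw [bubble, Finset.prod_insert (Finset.mem_sdiff.1 hz).2]
      simp only [Pi.mul_apply, bubble]
      ring
    rw [pow_succ', mul_assoc, ← hh, hsum]
    simp only [Pi.sub_apply, Finset.sum_apply]
    rw [h4]
    simp only [Pi.mul_apply, Finset.sum_apply]
    linear_combination (-(bubble K τ x * h x)) * h3

open scoped Pointwise in
/-- A monomial in the barycentric coordinates is a power of one coordinate or divisible by the
bubble of an edge. -/
theorem monomial_cases (K : T.Cell) (F : Finset (Pt d)) (n : ℕ) {f : Pt d → ℝ}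
    (hf : f ∈ ((fun w x => T.bary K w x) '' (F : Set (Pt d)) : Set (Pt d → ℝ)) ^ (n + 1)) :
    (∃ w ∈ F, f = (fun x => T.bary K w x) ^ (n + 1)) ∨
    ∃ τ ⊆ F, 2 ≤ τ.card ∧ τ.card ≤ n + 1 ∧
      ∃ h ∈ baryMod K τ ^ (n + 1 - τ.card), f = bubble K τ * h := by
  classical
  induction n generalizing f with
  | zero =>
    rw [zero_add, pow_one] at hf
    obtain ⟨w, hw, rfl⟩ := hf
    exact Or.inl ⟨w, hw, by simp⟩
  | succ n ih =>
    rw [pow_succ', Set.mem_mul] at hf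
    obtain ⟨_, ⟨z, hz, rfl⟩, f, hf, rfl⟩ := hf
    refine (ih hf).elim ?_ ?_
    · rintro ⟨w, hw, rfl⟩
      rcases eq_or_ne z w with rfl | hzw
      · exact Or.inl ⟨z, hz, (pow_succ' _ _).symm⟩
      · have hc : ({z, w} : Finset (Pt d)).card = 2 := Finset.card_pair hzw
        refine Or.inr ⟨{z, w}, by simp [Finset.insert_subset_iff, Finset.mem_coe.1 hz, hw],
          hc.ge, by omega, (fun x => T.bary K w x) ^ n, ?_, ?_⟩
        · rw [hc]
          exact Submodule.pow_mem_pow _ (bary_mem_baryMod K (by simp)) n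
        · rw [bubble, Finset.prod_pair hzw, pow_succ', mul_assoc]
    · rintro ⟨τ, hτF, h2, hn, h, hh, rfl⟩
      by_cases hzτ : z ∈ τ
      · refine Or.inr ⟨τ, hτF, h2, by omega, (fun x => T.bary K z x) * h, ?_, by ring⟩
        rw [show n + 1 + 1 - τ.card = (n + 1 - τ.card) + 1 by omega, pow_succ']
        exact Submodule.mul_mem_mul (bary_mem_baryMod K hzτ) hh
      · have hc := Finset.card_insert_of_notMem hzτ
        refine Or.inr ⟨insert z τ, Finset.insert_subset hz hτF, by omega, by omega, h, ?_, ?_⟩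
        · rw [show n + 1 + 1 - (insert z τ).card = n + 1 - τ.card by omega]
          exact pow_le_pow_left' (baryMod_mono K (Finset.subset_insert z τ)) _ hh
        · rw [show bubble K (insert z τ) = (fun x => T.bary K z x) * bubble K τ from
            Finset.prod_insert hzτ, mul_assoc]

/-- Modulo the functions orthogonal to `g`, a homogeneous polynomial of degree `k` is determined
by its values at the vertices. -/
theorem sub_vertex_values_mem_orthMod {k : ℕ} (hk : 0 < k) (A : T.Numbering) (K : T.Cell)
    {F : Finset (Pt d)} (hF : F ⊆ K.1) {g : Pt d → ℝ}
    (hg : ∀ i : T.FaceIndex k, i.face.1 ⊆ F → faceFun A i K ∈ orthMod F g)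
    {f : Pt d → ℝ} (hf : f ∈ baryMod K F ^ k) :
    f - ∑ z ∈ F, f z • (fun x => T.bary K z x) ^ k ∈ orthMod F g := by
  classical
  obtain ⟨n, rfl⟩ : ∃ n, k = n + 1 := ⟨k - 1, by omega⟩
  rw [baryMod, Submodule.span_pow] at hf
  induction hf using Submodule.span_induction with
  | mem f hf =>
    -- A pure power `λ_w ^ k` is reproduced by its vertex values; every other monomial contains an
    -- edge bubble, so it vanishes at the vertices and is orthogonal to `g`.
    rcases monomial_cases K F n hf with ⟨w, hw, rfl⟩ | ⟨τ, hτF, h2, hn, h, hh, rfl⟩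
    · rw [Finset.sum_eq_single_of_mem w hw fun z hz hzw => ?_]
      · rw [Pi.pow_apply, bary_vertex K w w (hF hw)]
        simp
      · rw [Pi.pow_apply, bary_vertex K w z (hF hz), if_neg hzw.symm]
        simp
    · rw [Finset.sum_eq_zero fun z hz => ?_, sub_zero]
      · exact bubble_mul_mem_orthMod A K hF hg _ τ hτF h2 (by omega) h hh
      · obtain ⟨w, hw, hwz⟩ := Finset.exists_mem_ne (by omega : 1 < τ.card) z
        rw [Pi.mul_apply, bubble, Finset.prod_apply, Finset.prod_eq_zero hw, zero_mul, zero_smul]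
        rw [bary_vertex K w z (hF hz), if_neg hwz]
  | zero => simp
  | add f f' _ _ h h' =>
    convert Submodule.add_mem _ h h' using 1
    simp only [Pi.add_apply, add_smul, Finset.sum_add_distrib]
    abel
  | smul c f _ h =>
    convert Submodule.smul_mem _ c h using 1
    simp only [Pi.smul_apply, smul_sub, Finset.smul_sum, smul_smul, smul_eq_mul]

/-! ### Facet functionals that vanish on the face functions -/

theorem jacobi_one (b n : ℕ) : jacobi 0 b n 1 = 1 := by
  unfold jacobi
  rw [Finset.sum_eq_single_of_mem n (by simp)]
  · simp
  · intro m hm hne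
    have : n - m ≠ 0 := by
      have := Finset.mem_range.1 hm
      omega
    simp [this]

theorem jacobi_neg_one (b n : ℕ) : jacobi 0 b n (-1) = (-1) ^ n * ((n + b).choose n : ℝ) := by
  unfold jacobi
  rw [Finset.sum_eq_single_of_mem 0 (by simp)]
  · norm_num
    ring
  · intro m hm hne
    simp [hne]

/-- Strictness is essential: equality holds for `b = 0` (that is, `d = 2`) and for `k = 1`. -/
theorem lt_choose (b k : ℕ) (hb : 1 ≤ b) (hk : 3 ≤ k) : b + 1 < (k + b).choose k := by
  have h1 : (2 + b).choose b ≤ (k + b).choose b := Nat.choose_le_choose b (by omega)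
  have h2 : (k + b).choose k = (k + b).choose b := Nat.choose_symm_add
  have h3 : (2 + b).choose b = (b + 2) * (b + 1) / 2 := by
    rw [← Nat.choose_symm_add, Nat.choose_two_right, Nat.add_comm 2 b]
    rfl
  have h4 : b + 2 ≤ (b + 2) * (b + 1) / 2 := by
    rw [Nat.le_div_iff_mul_le two_pos]
    exact Nat.mul_le_mul_left _ (by omega)
  omega

/-- The core of the argument: `1` and the Jacobi polynomials of the coordinates are compared through
their vertex values. -/
theorem one_mem_orthMod {k : ℕ} (hd : 3 ≤ d) (hk : 3 ≤ k) (hodd : Odd k) (A : T.Numbering)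
    (K : T.Cell) {F : Finset (Pt d)} (hF : F ⊆ K.1) (hcard : F.card = d) {g : Pt d → ℝ}
    (hgk : g ∈ polyLE d (k - 1))
    (hg : ∀ i : T.FaceIndex k, i.face.1 ⊆ F → faceFun A i K ∈ orthMod F g) :
    (1 : Pt d → ℝ) ∈ orthMod F g := by
  classical
  set s : Pt d → ℝ := ∑ z ∈ F, fun x => T.bary K z x with hs
  have hsV : s ∈ baryMod K F := Submodule.sum_mem _ fun z hz => bary_mem_baryMod K hz
  have hsF : ∀ x ∈ simplex F, s x = 1 := fun x hx => by
    simp only [hs, Finset.sum_apply]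
    exact sum_bary_of_mem K hF hx
  have hvert : ∀ z ∈ F, z ∈ simplex F := fun z hz => subset_convexHull ℝ _ hz
  set P : Pt d → ℝ := ∑ z ∈ F, (fun x => T.bary K z x) ^ k with hP
  have h1 : (1 : Pt d → ℝ) - P ∈ orthMod F g := by
    refine mem_orthMod_congr (sub_vertex_values_mem_orthMod (by omega) A K hF hg
      (Submodule.pow_mem_pow _ hsV k)) fun x hx => ?_
    have : ∑ z ∈ F, (s ^ k) z • (fun x => T.bary K z x) ^ k = P :=
      Finset.sum_congr rfl fun z hz => by
        rw [Pi.pow_apply, hsF z (hvert z hz), one_pow, one_smul]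
    rw [this]
    simp [hsF x hx]
  set p : ℝ := jacobi 0 (d - 2) k (-1) with hp
  have h2 : ∀ w ∈ F, P + (p - 1) • (fun x => T.bary K w x) ^ k ∈ orthMod F g := by
    intro w hw
    -- Homogenizing with `s`, which is `1` on `F`, puts `P_k^{(0,d-2)}(1 - 2λ_w)` into the `k`-th
    -- power of `baryMod K F`.
    set q := jacobiFun 0 (d - 2) k (s - fun x => T.bary K w x) s with hq
    have hqF : ∀ x ∈ simplex F, q x = jacobi 0 (d - 2) k (1 - 2 * T.bary K w x) := fun x hx => by
      simp only [hq, jacobiFun, Pi.sub_apply, hsF x hx]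
      rw [jacobiHom_eq _ _ _ _ _ one_ne_zero, one_pow, one_mul]
      congr 1
      ring
    have h3 := sub_vertex_values_mem_orthMod (by omega) A K hF hg
      (jacobiFun_mem_pow 0 (d - 2) k (baryMod K F |>.sub_mem hsV (bary_mem_baryMod K hw)) hsV)
    rw [← hq] at h3
    have h4 : ∑ z ∈ F, q z • (fun x => T.bary K z x) ^ k =
        P + (p - 1) • (fun x => T.bary K w x) ^ k := by
      rw [hP, ← Finset.add_sum_erase _ _ hw, ← Finset.add_sum_erase _ _ hw,
        Finset.sum_congr rfl (g := fun z => (fun x => T.bary K z x) ^ k) fun z hz => ?_]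
      · rw [hqF w (hvert w hw), bary_vertex K w w (hF hw), if_pos rfl,
          show (1 : ℝ) - 2 * 1 = -1 by norm_num, ← hp, sub_smul, one_smul]
        abel
      · have hz' := Finset.mem_erase.1 hz
        rw [hqF z (hvert z hz'.2), bary_vertex K w z (hF hz'.2), if_neg hz'.1.symm, mul_zero,
          sub_zero, jacobi_one, one_smul]
    rw [h4] at h3
    have h5 : q ∈ orthMod F g :=
      mem_orthMod_congr (jacobi_mem_orthMod K hF hcard (by omega) hw (by omega) hgk)
        fun x hx => (hqF x hx).symm
    simpa using Submodule.sub_mem _ h5 h3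
  have h3 : (d + (p - 1)) • P ∈ orthMod F g := by
    have := Submodule.sum_mem _ h2
    rwa [Finset.sum_add_distrib, Finset.sum_const, hcard, ← Finset.smul_sum, ← hP,
      ← Nat.cast_smul_eq_nsmul ℝ, ← add_smul] at this
  -- Oddness of `k` makes `p` negative, and the strict binomial bound gives `p < -(d - 1)`.
  have hne : (d + (p - 1) : ℝ) ≠ 0 := by
    have h := lt_choose (d - 2) k (by omega) hk
    have h' : ((d - 2 + 1 : ℕ) : ℝ) < (k + (d - 2)).choose k := by exact_mod_cast h
    rw [show d - 2 + 1 = d - 1 by omega, Nat.cast_sub (by omega)] at h'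
    rw [hp, jacobi_neg_one, hodd.neg_one_pow]
    push_cast at h'
    intro h0
    linarith
  have h4 : P ∈ orthMod F g := by
    have := Submodule.smul_mem _ (d + (p - 1) : ℝ)⁻¹ h3
    rwa [smul_smul, inv_mul_cancel₀ hne, one_smul] at this
  simpa using Submodule.add_mem _ h1 h4

/-- On `F` the function is `1 - (1/d) ∑_{z ∈ F} P_k^{(0,d-2)}(1 - 2λ_z)`, and each term is
orthogonal to `g`. -/
theorem facetFun_mem_orthMod {k : ℕ} (hd : 3 ≤ d) (hk : 3 ≤ k) (hodd : Odd k) (A : T.Numbering)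
    (K : T.Cell) (F : T.Facet) (hF : F.1 ⊆ K.1) {g : Pt d → ℝ} (hgk : g ∈ polyLE d (k - 1))
    (hg : ∀ i : T.FaceIndex k, i.face.1 ⊆ F.1 → faceFun A i K ∈ orthMod F.1 g) :
    T.facetFun k F K ∈ orthMod F.1 g := by
  classical
  have h1 := one_mem_orthMod hd hk hodd A K hF F.2.2 hgk hg
  have h2 := Submodule.sum_mem _ fun z hz =>
    jacobi_mem_orthMod (k := k) K hF F.2.2 (by omega) hz (by omega) hgk
  refine mem_orthMod_congr (Submodule.sub_mem _ h1 (Submodule.smul_mem _ (1 / (d : ℝ)) h2))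
    fun x hx => ?_
  have h0 : ∀ z ∈ K.1 \ F.1, T.bary K z x = 0 := fun z hz =>
    ((mem_simplex_iff K hF).1 hx).2 z (Finset.mem_sdiff.1 hz).1 (Finset.mem_sdiff.1 hz).2
  have hc : (K.1 \ F.1).card = 1 := by
    rw [Finset.card_sdiff_of_subset hF, K.2.2, F.2.2]
    omega
  -- The vertex opposite to `F` contributes `1` on `F`, which cancels the `-1` in `B_k^{CR,K}`.
  have h3 : ∑ z ∈ K.1 \ F.1, jacobi 0 (d - 2) k (1 - 2 * T.bary K z x) = 1 := by
    rw [Finset.sum_congr rfl fun z hz => by rw [h0 z hz, mul_zero, sub_zero, jacobi_one],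
      Finset.sum_const, hc, one_smul]
  simp only [facetFun, if_pos hF, simplexFun, Finset.sum_eq_zero h0, mul_zero, sub_zero,
    jacobi_one, ← Finset.sum_sdiff hF, h3, Pi.sub_apply, Pi.one_apply, Pi.smul_apply,
    Finset.sum_apply, smul_eq_mul]
  ring

/-- A facet functional that vanishes on the face functions of all faces of `F` vanishes on the
non-conforming facet function of `F`. -/
theorem facetFunctional_eq_zero {k : ℕ} (hd : 3 ≤ d) (hk : 3 ≤ k) (hodd : Odd k)
    (A : T.Numbering) (F : T.Facet) {V : Submodule ℝ T.Broken} {J : Module.Dual ℝ V}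
    (hJ : IsFacetFunctional k F J)
    (h : ∀ i : T.FaceIndex k, i.face.1 ⊆ F.1 → ∃ u : V, u.1 = faceFun A i ∧ J u = 0)
    (u : V) (hu : u.1 = T.facetFun k F) : J u = 0 := by
  obtain ⟨g, hg, K, hFK, hJ⟩ := hJ
  have hgc : Continuous g := by
    obtain ⟨p, -, hp⟩ := hg
    rw [funext hp]
    exact (MvPolynomial.continuous_eval p).comp (by fun_prop)
  rw [hJ, hu]
  refine (facetFun_mem_orthMod hd hk hodd A K F hFK hg fun i hi => ?_).2
  obtain ⟨v, hv, hv0⟩ := h i hi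
  refine ⟨integrableOn_simplex K hFK F.2.2 (by omega) (hgc.mul ?_), ?_⟩
  · obtain ⟨p, -, hp⟩ := (faceFun_mem_conf A i).1 K
    rw [funext hp]
    exact (MvPolynomial.continuous_eval p).comp (by fun_prop)
  · rw [← hv, ← hJ, hv0]

/-! ### Facets of a cell and faces away from the boundary -/

theorem exists_facet_subset (K : T.Cell) (hd : 0 < d) : ∃ F : T.Facet, F.1 ⊆ K.1 := by
  obtain ⟨F, hFK, hF⟩ := Finset.exists_subset_card_eq (show d ≤ K.1.card by rw [K.2.2]; omega)
  exact ⟨⟨F, T.complex.down_closed K.2.1 hFK (Finset.card_pos.1 (by omega)), hF⟩, hFK⟩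

theorem not_subset_frontier (K : T.Cell) (hK : simplex K.1 ∩ frontier Ω = ∅) {τ : Finset (Pt d)}
    (hτ : τ ∈ T.complex.faces) (hτK : τ ⊆ K.1) : ¬ simplex τ ⊆ frontier Ω := by
  intro h
  obtain ⟨z, hz⟩ := T.complex.nonempty_of_mem_faces hτ
  have hzτ : z ∈ simplex τ := subset_convexHull ℝ _ hz
  have : z ∈ simplex K.1 ∩ frontier Ω :=
    ⟨convexHull_mono (Finset.coe_subset.2 hτK) hzτ, h hzτ⟩
  simp [hK] at this

end SimplicialMesh

end

end CrouzeixRaviart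

/-! ### The contradiction at one facet -/

theorem mainTheorem4 (d k : ℕ) (hd : 3 ≤ d) (hk : 3 ≤ k) (hodd : Odd k)
    (Ω : Set (CrouzeixRaviart.Pt d)) (T : CrouzeixRaviart.SimplicialMesh Ω) (A : T.Numbering)
    (mark : T.Face → T.Cell ⊕ T.Facet) (hmark : T.IsAssignment mark) :
    (¬ ∃ J : T.FaceIndex k ⊕ T.Facet → Module.Dual ℝ (T.CR k),
      (∀ i : T.FaceIndex k,
        CrouzeixRaviart.SimplicialMesh.IsFaceFunctional k mark i.face (J (Sum.inl i))) ∧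
      (∀ F : T.Facet,
        CrouzeixRaviart.SimplicialMesh.IsFacetFunctional k F (J (Sum.inr F))) ∧
      CrouzeixRaviart.IsBidual (CrouzeixRaviart.SimplicialMesh.basisCR A) J) ∧
    ((∃ K : T.Cell, CrouzeixRaviart.simplex K.1 ∩ frontier Ω = ∅) →
      ¬ ∃ J : T.InnerFaceIndex k ⊕ T.InnerFacet → Module.Dual ℝ (T.CR₀ k),
        (∀ i : T.InnerFaceIndex k,
          CrouzeixRaviart.SimplicialMesh.IsFaceFunctional k mark i.1.face (J (Sum.inl i))) ∧
        (∀ F : T.InnerFacet,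
          CrouzeixRaviart.SimplicialMesh.IsFacetFunctional k F.1 (J (Sum.inr F))) ∧
        CrouzeixRaviart.IsBidual (CrouzeixRaviart.SimplicialMesh.basisCR₀ A) J) := by
  refine ⟨?_, ?_⟩
  · rintro ⟨J, -, hfacet, hdual⟩
    obtain ⟨y, hy⟩ := T.nonempty
    obtain ⟨K, -⟩ := CrouzeixRaviart.SimplicialMesh.exists_cell (T := T) (subset_closure hy)
    obtain ⟨F, -⟩ := CrouzeixRaviart.SimplicialMesh.exists_facet_subset K (by omega)
    have h1 := hdual (Sum.inr F) (Sum.inr F)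
    rw [if_pos rfl, CrouzeixRaviart.SimplicialMesh.facetFunctional_eq_zero hd hk hodd A F
      (hfacet F) (fun i _ => ⟨CrouzeixRaviart.SimplicialMesh.basisCR A (Sum.inl i), rfl, ?_⟩)
      (CrouzeixRaviart.SimplicialMesh.basisCR A (Sum.inr F)) rfl] at h1
    · exact zero_ne_one h1
    · rw [hdual, if_neg Sum.inr_ne_inl]
  · rintro ⟨K, hK⟩ ⟨J, -, hfacet, hdual⟩
    obtain ⟨F, hFK⟩ := CrouzeixRaviart.SimplicialMesh.exists_facet_subset K (by omega)
    -- Since `K` does not meet `∂Ω`, neither `F` nor any face of `F` lies in `∂Ω`; all face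
    -- functions needed on `F` therefore belong to the basis of the space with boundary condition.
    have hF := CrouzeixRaviart.SimplicialMesh.not_subset_frontier K hK F.2.1 hFK
    have h1 := hdual (Sum.inr ⟨F, hF⟩) (Sum.inr ⟨F, hF⟩)
    rw [if_pos rfl, CrouzeixRaviart.SimplicialMesh.facetFunctional_eq_zero hd hk hodd A F
      (hfacet ⟨F, hF⟩) (fun i hi => ⟨CrouzeixRaviart.SimplicialMesh.basisCR₀ A (Sum.inl ⟨i,
        CrouzeixRaviart.SimplicialMesh.not_subset_frontier K hK i.face.2 (hi.trans hFK)⟩),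
        rfl, ?_⟩)
      (CrouzeixRaviart.SimplicialMesh.basisCR₀ A (Sum.inr ⟨F, hF⟩)) rfl] at h1
    · exact zero_ne_one h1
    · rw [hdual, if_neg Sum.inr_ne_inl]
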